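/- Objects are coded by binary strings and $|x|$ denotes the length of the string $x$; an oracle is a set $W\subseteq\{0,1\}^*$, and "polynomial time relative to $W$" refers to oracle machines that may ask whether a string belongs to $W$. - Propositional formulas relative to $W$ are built from variables, $\top,\bot,\neg,\wedge,\vee$ and, for each $k\ge 0$, a $k$-ary oracle connective $\alpha(\varphi_1,\dots,\varphi_k)$, which is true iff the string of the truth values of $\varphi_1,\dots,\varphi_k$ belongs to $W$. $\mathsf{TAUT}^W$ is the set of codes of those formulas that are true relative to $W$ under every assignment. - A proof system for a set $C\subseteq\{0,1\}^*$ relative to $W$ is a function $P:\{0,1\}^*\to\{0,1\}^*$, computable in polynomial time relative to $W$, whose range is $C$. It is nonuniform p-optimal if for every proof system $Q$ for $C$ relative to $W$ there is a polynomial $h$ such that for all $\pi$ and all $x\in C$ with $Q(\pi)=x$ there is $\pi'$ with $|\pi'|\le h(|\pi|)$ and $P(\pi')=x$. - $\mathsf{TFNP}^W$ is the class of search problems $(p,R)$, where $p$ is a polynomial and $R$ is a binary relation on strings decidable in polynomial time relative to $W$, such that for every $x$ there is $y$ with $|y|\le p(|x|)$ and $R(x,y)$. $\mathsf{FP}^W$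 is the class of those search problems $(p,R)$, with $p$ and $R$ as before, for which there is a function $f$ computable in polynomial time relative to $W$ with $|f(x)|\le p(|x|)$ and $R(x,f(x))$ for every $x$. Theorem 5.2. There exists an oracle $W$ such that there is no nonuniform p-optimal proof system for $\mathsf{TAUT}^W$, but $\mathsf{TFNP}^W=\mathsf{FP}^W$. -/

import Mathlib

/-! ## Oracles and oracle machines

Objects are coded by binary strings `List Bool`; the length of an object is the length of its code.
An oracle is a set of binary strings, given by its characteristic function. -/

/-- An oracle: the characteristic function of a set of binary strings. -/
abbrev Oracle : Type := List Bool → Bool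

namespace Oracle

/-- Programs of an oracle machine with finitely many work tapes. Each tape (register) is a stack
of bits, the head of the list being the top; a two-way tape is a pair of stacks. The finite control
is a structured program over the instructions "write a symbol", "erase a symbol", "branch on the
scanned symbol" and "branch on the answer of the oracle to the string on a tape". -/
inductive Prog : Type
  /-- Do nothing. -/
  | skip : Prog
  /-- Push the bit `b` on tape `r`. -/
  | push (r : ℕ) (b : Bool) : Prog
  /-- Remove the top bit of tape `r` (if there is one). -/
  | pop (r : ℕ) : Prog
  /-- Sequential composition. -/
  | seq (p q : Prog) : Prog
  /-- Look at the top symbol of tape `r`: continue with `pNil` if the tape is empty, with `pFalse`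
  if the top symbol is `false`, with `pTrue` if the top symbol is `true`. -/
  | branch (r : ℕ) (pNil pFalse pTrue : Prog) : Prog
  /-- While tape `r` is nonempty, execute `p`. -/
  | loop (r : ℕ) (p : Prog) : Prog
  /-- Ask the oracle about the content of tape `r`: continue with `pYes` if the content belongs to
  the oracle, with `pNo` otherwise. The tape is left unchanged. -/
  | query (r : ℕ) (pYes pNo : Prog) : Prog

/-- The contents of all tapes. A program mentions only finitely many of them. -/
abbrev Store : Type := ℕ → List Bool

/-- `Exec W p s t s'`: with oracle `W`, the program `p` started on the tape contents `s` halts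
after exactly `t` steps with tape contents `s'`. Each elementary instruction, each test and each
oracle query counts as one step. -/
inductive Exec (W : Oracle) : Prog → Store → ℕ → Store → Prop
  | skip (s : Store) : Exec W Prog.skip s 1 s
  | push (r : ℕ) (b : Bool) (s : Store) :
      Exec W (Prog.push r b) s 1 (Function.update s r (b :: s r))
  | pop (r : ℕ) (s : Store) :
      Exec W (Prog.pop r) s 1 (Function.update s r (s r).tail)
  | seq {p q : Prog} {s₁ s₂ s₃ : Store} {t₁ t₂ : ℕ}
      (h₁ : Exec W p s₁ t₁ s₂) (h₂ : Exec W q s₂ t₂ s₃) :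
      Exec W (Prog.seq p q) s₁ (t₁ + t₂) s₃
  | branchNil {r : ℕ} {pNil pFalse pTrue : Prog} {s s' : Store} {t : ℕ}
      (hs : s r = []) (h : Exec W pNil s t s') :
      Exec W (Prog.branch r pNil pFalse pTrue) s (t + 1) s'
  | branchFalse {r : ℕ} {pNil pFalse pTrue : Prog} {s s' : Store} {t : ℕ}
      (hs : (s r).head? = some false) (h : Exec W pFalse s t s') :
      Exec W (Prog.branch r pNil pFalse pTrue) s (t + 1) s'
  | branchTrue {r : ℕ} {pNil pFalse pTrue : Prog} {s s' : Store} {t : ℕ}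
      (hs : (s r).head? = some true) (h : Exec W pTrue s t s') :
      Exec W (Prog.branch r pNil pFalse pTrue) s (t + 1) s'
  | loopDone {r : ℕ} {p : Prog} {s : Store} (hs : s r = []) :
      Exec W (Prog.loop r p) s 1 s
  | loopStep {r : ℕ} {p : Prog} {s₁ s₂ s₃ : Store} {t₁ t₂ : ℕ}
      (hs : s₁ r ≠ []) (h₁ : Exec W p s₁ t₁ s₂) (h₂ : Exec W (Prog.loop r p) s₂ t₂ s₃) :
      Exec W (Prog.loop r p) s₁ (t₁ + t₂ + 1) s₃
  | queryYes {r : ℕ} {pYes pNo : Prog} {s s' : Store} {t : ℕ}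
      (hs : W (s r) = true) (h : Exec W pYes s t s') :
      Exec W (Prog.query r pYes pNo) s (t + 1) s'
  | queryNo {r : ℕ} {pYes pNo : Prog} {s s' : Store} {t : ℕ}
      (hs : W (s r) = false) (h : Exec W pNo s t s') :
      Exec W (Prog.query r pYes pNo) s (t + 1) s'

/-- The initial tape contents: the inputs on the tapes `0, 1, …`, all other tapes empty. -/
def initStore (inputs : List (List Bool)) : Store := fun r => inputs.getD r []

/-- With oracle `W`, on the given inputs, the program `p` halts within `T` steps and leaves
the string `out` on tape `0`. -/
def OutputsWithin (W : Oracle) (p : Prog) (inputs : List (List Bool)) (T : ℕ)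
    (out : List Bool) : Prop :=
  ∃ t ≤ T, ∃ s' : Store, Exec W p (initStore inputs) t s' ∧ s' 0 = out

/-- `f` is computable in polynomial time relative to `W`. -/
def IsPolyTimeFun (W : Oracle) (f : List Bool → List Bool) : Prop :=
  ∃ (p : Prog) (q : Polynomial ℕ), ∀ x : List Bool,
    OutputsWithin W p [x] (q.eval x.length) (f x)

/-- The binary relation `R` on strings is decidable in polynomial time relative to `W`
(a computation accepts iff its output is the string `1`). -/
def IsPolyTimeRel (W : Oracle) (R : List Bool → List Bool → Prop) : Prop :=
  ∃ (p : Prog) (q : Polynomial ℕ), ∀ x y : List Bool, ∃ out : List Bool,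
    OutputsWithin W p [x, y] (q.eval (x.length + y.length)) out ∧ (out = [true] ↔ R x y)

/-! ## Search problems -/

/-- A search problem is a pair `(p, R)`: given `x`, find `y` with `|y| ≤ p(|x|)` and `R(x, y)`. -/
abbrev SearchProblem : Type := Polynomial ℕ × (List Bool → List Bool → Prop)

/-- `y` is a solution of the search problem `S` on the instance `x`. -/
def SearchProblem.IsSolution (S : SearchProblem) (x y : List Bool) : Prop :=
  y.length ≤ S.1.eval x.length ∧ S.2 x y

/-- The total NP search problems relative to `W`. -/
def TFNP (W : Oracle) : Set SearchProblem :=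
  {S | IsPolyTimeRel W S.2 ∧ ∀ x, ∃ y, S.IsSolution x y}

/-- The class FP relative to `W`, as a class of search problems: the NP search problems which are
solved by a polynomial time function. -/
def FP (W : Oracle) : Set SearchProblem :=
  {S | IsPolyTimeRel W S.2 ∧
    ∃ f : List Bool → List Bool, IsPolyTimeFun W f ∧ ∀ x, S.IsSolution x (f x)}

/-! ## Relativized propositional logic -/

/-- Propositional formulas with, for each `k`, a `k`-ary oracle connective. -/
inductive Formula : Type
  | var (i : ℕ) : Formula
  | verum : Formula
  | falsum : Formula
  | neg (φ : Formula) : Formula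
  | and (φ ψ : Formula) : Formula
  | or (φ ψ : Formula) : Formula
  | oracle (k : ℕ) (args : Fin k → Formula) : Formula

/-- The truth value of a formula relative to `W` under the assignment `v`. The oracle connective
applied to `φ₁, …, φₖ` is true iff the string of the truth values of `φ₁, …, φₖ` belongs
to `W`. -/
def Formula.eval (W : Oracle) (v : ℕ → Bool) : Formula → Bool
  | .var i => v i
  | .verum => true
  | .falsum => false
  | .neg φ => !(φ.eval W v)
  | .and φ ψ => φ.eval W v && ψ.eval W v
  | .or φ ψ => φ.eval W v || ψ.eval W v
  | .oracle _ args => W (List.ofFn fun j => (args j).eval W v)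

/-- Self-delimiting code of a natural number: its binary digits (least significant first) are
doubled and `01` is appended. -/
def encodeNat (n : ℕ) : List Bool :=
  (Nat.bits n).flatMap (fun b => [b, b]) ++ [false, true]

/-- The binary code of a formula, in prefix notation: each symbol has a three-bit tag, followed by
the index for a variable, and by the arity for an oracle connective. -/
def Formula.encode : Formula → List Bool
  | .var i => [false, false, false] ++ encodeNat i
  | .verum => [false, false, true]
  | .falsum => [false, true, false]
  | .neg φ => [false, true, true] ++ φ.encode
  | .and φ ψ => [true, false, false] ++ (φ.encode ++ ψ.encode)
  | .or φ ψ => [true, false, true] ++ (φ.encode ++ ψ.encode)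
  | .oracle k args =>
      [true, true, false] ++ (encodeNat k ++ (List.ofFn fun j => (args j).encode).flatten)

/-- The set of (codes of) tautologies relative to `W`. -/
def TAUT (W : Oracle) : Set (List Bool) :=
  {x | ∃ φ : Formula, φ.encode = x ∧ ∀ v : ℕ → Bool, φ.eval W v = true}

/-! ## Proof systems -/

/-- `P` is a proof system for the set `C` relative to `W`: a polynomial time function relative
to `W` with range `C`. -/
def IsProofSystem (W : Oracle) (C : Set (List Bool)) (P : List Bool → List Bool) : Prop :=
  IsPolyTimeFun W P ∧ Set.range P = C

/-- `P` nonuniformly p-simulates `Q` (as proof systems for `C`). -/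
def NonuniformPSimulates (C : Set (List Bool)) (P Q : List Bool → List Bool) : Prop :=
  ∃ h : Polynomial ℕ, ∀ π : List Bool, ∀ x ∈ C, Q π = x →
    ∃ π' : List Bool, π'.length ≤ h.eval π.length ∧ P π' = x

/-- `P` is a nonuniform p-optimal proof system for `C` relative to `W`. -/
def IsNonuniformPOptimal (W : Oracle) (C : Set (List Bool)) (P : List Bool → List Bool) : Prop :=
  IsProofSystem W C P ∧ ∀ Q, IsProofSystem W C Q → NonuniformPSimulates C P Q

end Oracle

/-!
The oracle `world A` is determined by a sparse set `A` of secret strings, one for each of some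
rapidly growing lengths; `false :: u` belongs to it iff `u` is secret. All other queries ask for help
with a computation: there, the oracle is as powerful as one likes, because the sets of programs and
polynomials are just enumerated (`task`), and because nothing has to be computable. The one
restriction is that the answer to a query `S` depends only on `view A S`: on the secrets that are
old in comparison with the length of `S`, and on those which are spelled in `S` (`world_view`).

*No optimal proof system.* The formula `emptiness n` says that there is no secret of length `n`. At
stage `i` of the construction, `task i` is a program for a proof system together with a polynomial
`h`. For a large `n` from the region of that program, see whether the program has, relative to the
secrets so far, a proof of `emptiness n` of length at most `h (n + 1)`. If so, that computation
makes polynomially many queries, which spell fewer than `2 ^ n` strings of length `n`; hence a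
secret of length `n` can be added without changing the computation, and the proof system becomes
unsound. If not, add nothing. A genuine proof system therefore has no short proofs of certain
`emptiness n`, while there are no secrets in its whole region, so that adding trivial proofs of all
`emptiness n` for `n` in this region gives a proof system that is not simulated
(`no_isNonuniformPOptimal`).

*Total search problems are easy.* Before stage `i` chooses `n`, it secures that every search problem
of index less than `i` that has an instance without solution, relative to the secrets so far, keeps
one (`IsStage`). So a search problem that is total in the end is total in the world without
the secret `a` of any later stage (`stages_search`). To solve it, obtain from the oracle a solution in
the world without `a`, where `a` is the only secret that matters and is not known, and let the oracle
spell all queries made in verifying this solution. If none of them spells `a`, the solution is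
correct. Otherwise `a` has now been spelled, and the oracle can give a solution in the true world
(`IsTranscript.isSol`). The machine merely has to record the answers of the oracle (`guided`).
-/

namespace Oracle

/-! ### Executions of oracle programs -/

theorem Exec.deterministic {W : Oracle} {p : Prog} {s s₁ s₂ : Store} {t₁ t₂ : ℕ}
    (h₁ : Exec W p s t₁ s₁) (h₂ : Exec W p s t₂ s₂) : t₁ = t₂ ∧ s₁ = s₂ := by
  induction h₁ generalizing t₂ s₂ with
  | skip | push | pop => cases h₂; exact ⟨rfl, rfl⟩
  | seq _ _ ih ih' =>
    cases h₂ with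
    | seq k k' =>
      obtain ⟨rfl, rfl⟩ := ih k
      obtain ⟨rfl, rfl⟩ := ih' k'
      exact ⟨rfl, rfl⟩
  | branchNil hs _ ih | branchFalse hs _ ih | branchTrue hs _ ih =>
    cases h₂ with
    | branchNil hs' k | branchFalse hs' k | branchTrue hs' k =>
      first
        | (obtain ⟨rfl, rfl⟩ := ih k; exact ⟨rfl, rfl⟩)
        | simp_all
  | loopDone hs =>
    cases h₂ with
    | loopDone => exact ⟨rfl, rfl⟩
    | loopStep hs' => exact absurd hs hs'
  | loopStep hs _ _ ih ih' =>
    cases h₂ with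
    | loopDone hs' => exact absurd hs' hs
    | loopStep _ k k' =>
      obtain ⟨rfl, rfl⟩ := ih k
      obtain ⟨rfl, rfl⟩ := ih' k'
      exact ⟨rfl, rfl⟩
  | queryYes hs _ ih | queryNo hs _ ih =>
    cases h₂ with
    | queryYes hs' k | queryNo hs' k =>
      first
        | (obtain ⟨rfl, rfl⟩ := ih k; exact ⟨rfl, rfl⟩)
        | simp_all

theorem OutputsWithin.unique {W : Oracle} {p : Prog} {i : List (List Bool)} {T T' : ℕ}
    {o o' : List Bool} (h : OutputsWithin W p i T o) (h' : OutputsWithin W p i T' o') :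
    o = o' := by
  obtain ⟨t, _, s, hs, rfl⟩ := h
  obtain ⟨t', _, s', hs', rfl⟩ := h'
  rw [(hs.deterministic hs').2]

theorem OutputsWithin.mono {W : Oracle} {p : Prog} {i : List (List Bool)} {T T' : ℕ}
    {o : List Bool} (h : OutputsWithin W p i T o) (hT : T ≤ T') : OutputsWithin W p i T' o := by
  obtain ⟨t, ht, h⟩ := h
  exact ⟨t, ht.trans hT, h⟩

/-- A computation of `t` steps makes at most `t` queries, and the tapes, hence the queries, grow
by at most one symbol per step; the computation is the same for every oracle that gives the same
answers to these queries. -/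
theorem Exec.exists_queries {W : Oracle} {p : Prog} {s s' : Store} {t : ℕ}
    (h : Exec W p s t s') : ∀ M, (∀ r, (s r).length ≤ M) → (∀ r, (s' r).length ≤ M + t) ∧
      ∃ Qs : List (List Bool), Qs.length ≤ t ∧ (∀ q ∈ Qs, q.length ≤ M + t) ∧
        ∀ W' : Oracle, (∀ q ∈ Qs, W' q = W q) → Exec W' p s t s' := by
  induction h with
  | skip s =>
    intro M hM
    exact ⟨fun r => (hM r).trans (by omega), [], by simp, by simp, fun W' _ => .skip s⟩
  | push r b s =>
    intro M hM
    refine ⟨fun r' => ?_, [], by simp, by simp, fun W' _ => .push r b s⟩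
    have := hM r'
    by_cases h : r' = r
    · subst h; simpa using this
    · simp only [Function.update_of_ne h]; omega
  | pop r s =>
    intro M hM
    refine ⟨fun r' => ?_, [], by simp, by simp, fun W' _ => .pop r s⟩
    have := hM r'
    by_cases h : r' = r
    · subst h; simp only [Function.update_self, List.length_tail]; omega
    · simp only [Function.update_of_ne h]; omega
  | seq _ _ ih ih' =>
    intro M hM
    obtain ⟨h1, Qs, hl, hq, hW⟩ := ih M hM
    obtain ⟨h1', Qs', hl', hq', hW'⟩ := ih' _ h1
    refine ⟨fun r => (h1' r).trans (by omega), Qs ++ Qs', by simp; omega, ?_, ?_⟩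
    · intro q hq1
      rcases List.mem_append.1 hq1 with hq1 | hq1
      · exact (hq q hq1).trans (by omega)
      · exact (hq' q hq1).trans (by omega)
    · intro V hV
      exact .seq (hW V fun q hq => hV q (by simp [hq])) (hW' V fun q hq => hV q (by simp [hq]))
  | branchNil hs _ ih =>
    intro M hM
    obtain ⟨h1, Qs, hl, hq, hW⟩ := ih M hM
    exact ⟨fun r => (h1 r).trans (by omega), Qs, by omega, fun q hq1 => (hq q hq1).trans (by omega),
      fun V hV => .branchNil hs (hW V hV)⟩
  | branchFalse hs _ ih =>
    intro M hM
    obtain ⟨h1, Qs, hl, hq, hW⟩ := ih M hM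
    exact ⟨fun r => (h1 r).trans (by omega), Qs, by omega, fun q hq1 => (hq q hq1).trans (by omega),
      fun V hV => .branchFalse hs (hW V hV)⟩
  | branchTrue hs _ ih =>
    intro M hM
    obtain ⟨h1, Qs, hl, hq, hW⟩ := ih M hM
    exact ⟨fun r => (h1 r).trans (by omega), Qs, by omega, fun q hq1 => (hq q hq1).trans (by omega),
      fun V hV => .branchTrue hs (hW V hV)⟩
  | loopDone hs =>
    intro M hM
    exact ⟨fun r => (hM r).trans (by omega), [], by simp, by simp, fun W' _ => .loopDone hs⟩
  | loopStep hs _ _ ih ih' =>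
    intro M hM
    obtain ⟨h1, Qs, hl, hq, hW⟩ := ih M hM
    obtain ⟨h1', Qs', hl', hq', hW'⟩ := ih' _ h1
    refine ⟨fun r => (h1' r).trans (by omega), Qs ++ Qs', by simp; omega, ?_, ?_⟩
    · intro q hq1
      rcases List.mem_append.1 hq1 with hq1 | hq1
      · exact (hq q hq1).trans (by omega)
      · exact (hq' q hq1).trans (by omega)
    · intro V hV
      exact .loopStep hs (hW V fun q hq => hV q (by simp [hq]))
        (hW' V fun q hq => hV q (by simp [hq]))
  | @queryYes r _ _ s _ _ hs _ ih =>
    intro M hM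
    obtain ⟨h1, Qs, hl, hq, hW⟩ := ih M hM
    refine ⟨fun r => (h1 r).trans (by omega), s r :: Qs, by simp; omega, ?_, fun V hV =>
      .queryYes ((hV _ (by simp)).trans hs) (hW V fun q hq => hV q (by simp [hq]))⟩
    intro q hq1
    rcases List.mem_cons.1 hq1 with rfl | hq1
    · exact (hM r).trans (by omega)
    · exact (hq q hq1).trans (by omega)
  | @queryNo r _ _ s _ _ hs _ ih =>
    intro M hM
    obtain ⟨h1, Qs, hl, hq, hW⟩ := ih M hM
    refine ⟨fun r => (h1 r).trans (by omega), s r :: Qs, by simp; omega, ?_, fun V hV =>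
      .queryNo ((hV _ (by simp)).trans hs) (hW V fun q hq => hV q (by simp [hq]))⟩
    intro q hq1
    rcases List.mem_cons.1 hq1 with rfl | hq1
    · exact (hM r).trans (by omega)
    · exact (hq q hq1).trans (by omega)

theorem OutputsWithin.exists_queries {W : Oracle} {p : Prog} {i : List (List Bool)} {T M : ℕ}
    {o : List Bool} (h : OutputsWithin W p i T o) (hM : ∀ x ∈ i, x.length ≤ M) :
    ∃ Qs : List (List Bool), Qs.length ≤ T ∧ (∀ q ∈ Qs, q.length ≤ M + T) ∧
      ∀ W' : Oracle, (∀ q ∈ Qs, W' q = W q) → OutputsWithin W' p i T o := by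
  obtain ⟨t, ht, s, hs, rfl⟩ := h
  obtain ⟨-, Qs, hl, hq, hW⟩ := hs.exists_queries M fun r => by
    unfold initStore
    by_cases hr : r < i.length
    · rw [List.getD_eq_getElem _ _ hr]; exact hM _ (List.getElem_mem hr)
    · rw [List.getD_eq_default _ _ (not_lt.1 hr)]; simp
  exact ⟨Qs, hl.trans ht, fun q hq1 => (hq q hq1).trans (by omega),
    fun V hV => ⟨t, ht, s, hW V hV, rfl⟩⟩

theorem OutputsWithin.congr {W W' : Oracle} {p : Prog} {i : List (List Bool)} {T M : ℕ}
    {o : List Bool} (h : OutputsWithin W p i T o) (hM : ∀ x ∈ i, x.length ≤ M)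
    (hW : ∀ q : List Bool, q.length ≤ M + T → W' q = W q) : OutputsWithin W' p i T o := by
  obtain ⟨Qs, -, hq, hQ⟩ := h.exists_queries hM
  exact hQ W' fun q hq1 => hW q (hq q hq1)

/-- With oracle `W`, the program `p` leads from `s` to `s'` within `T` steps. -/
def Runs (W : Oracle) (p : Prog) (s : Store) (T : ℕ) (s' : Store) : Prop :=
  ∃ t ≤ T, Exec W p s t s'

namespace Runs

variable {W : Oracle} {p q : Prog} {s s₁ s₂ : Store} {T T₁ T₂ r : ℕ}

theorem mono (h : Runs W p s T s₁) (hT : T ≤ T₁) : Runs W p s T₁ s₁ := by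
  obtain ⟨t, ht, h⟩ := h
  exact ⟨t, ht.trans hT, h⟩

theorem seq (h₁ : Runs W p s T₁ s₁) (h₂ : Runs W q s₁ T₂ s₂) :
    Runs W (p.seq q) s (T₁ + T₂) s₂ := by
  obtain ⟨t₁, ht₁, h₁⟩ := h₁
  obtain ⟨t₂, ht₂, h₂⟩ := h₂
  exact ⟨_, by omega, h₁.seq h₂⟩

theorem push (b : Bool) : Runs W (.push r b) s 1 (Function.update s r (b :: s r)) :=
  ⟨1, le_rfl, .push r b s⟩

theorem pop : Runs W (.pop r) s 1 (Function.update s r (s r).tail) :=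
  ⟨1, le_rfl, .pop r s⟩

theorem loopDone (hs : s r = []) : Runs W (.loop r p) s 1 s :=
  ⟨1, le_rfl, .loopDone hs⟩

theorem loopStep (hs : s r ≠ []) (h₁ : Runs W p s T₁ s₁)
    (h₂ : Runs W (.loop r p) s₁ T₂ s₂) : Runs W (.loop r p) s (T₁ + T₂ + 1) s₂ := by
  obtain ⟨t₁, ht₁, h₁⟩ := h₁
  obtain ⟨t₂, ht₂, h₂⟩ := h₂
  exact ⟨_, by omega, .loopStep hs h₁ h₂⟩

theorem branch {pn pf pt : Prog} {b : Bool} (hs : (s r).head? = some b)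
    (h : Runs W (if b then pt else pf) s T s₁) : Runs W (.branch r pn pf pt) s (T + 1) s₁ := by
  obtain ⟨t, ht, h⟩ := h
  cases b
  · exact ⟨_, by omega, .branchFalse hs h⟩
  · exact ⟨_, by omega, .branchTrue hs h⟩

theorem query {b : Bool} (hs : W (s r) = b)
    (h : Runs W (if b then p else q) s T s₁) : Runs W (.query r p q) s (T + 1) s₁ := by
  obtain ⟨t, ht, h⟩ := h
  cases b
  · exact ⟨_, by omega, .queryNo hs h⟩
  · exact ⟨_, by omega, .queryYes hs h⟩

end Runs

/-! ### A program that is guided by the oracle -/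

/-- Branch on the answer to the query `true :: tag :: S`, where `S` is the content of tape `1`. -/
def ask (tag : Bool) (p q : Prog) : Prog :=
  (Prog.push 1 tag).seq ((Prog.push 1 true).seq
    (Prog.query 1 ((Prog.pop 1).seq ((Prog.pop 1).seq p)) ((Prog.pop 1).seq ((Prog.pop 1).seq q))))

theorem Runs.ask {W : Oracle} {p q : Prog} {s s₁ : Store} {T : ℕ} {tag b : Bool}
    (hs : W (true :: tag :: s 1) = b) (h : Runs W (if b then p else q) s T s₁) :
    Runs W (Oracle.ask tag p q) s (T + 5) s₁ := by
  have key : ∀ p', Runs W p' s T s₁ → Runs W ((Prog.pop 1).seq ((Prog.pop 1).seq p'))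
      (Function.update s 1 (true :: tag :: s 1)) (1 + (1 + T)) s₁ := by
    intro p' h'
    refine Runs.pop.seq (Runs.pop.seq ?_)
    simpa using h'
  have : Runs W (Oracle.ask tag p q) s (1 + (1 + ((1 + (1 + T)) + 1))) s₁ := by
    refine (Runs.push tag).seq ((Runs.push true).seq ?_)
    refine Runs.query (b := b) (by simpa using hs) ?_
    cases b <;> simpa using key _ (by simpa using h)
  exact this.mono (by omega)

/-- As long as the oracle says so (`ask false`), append a bit chosen by the oracle (`ask true`)
to tape `1`, and to tape `r` too. The loop is controlled by tape `2`. -/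
def listen (r : ℕ) : Prog :=
  .loop 2 (ask false
    (ask true ((Prog.push 1 true).seq (.push r true)) ((Prog.push 1 false).seq (.push r false)))
    (.pop 2))

/-- The list `D` consists of the bits chosen by the oracle. -/
theorem Runs.listen {W : Oracle} {r : ℕ} (hr1 : r ≠ 1) (hr2 : r ≠ 2) (D : List Bool) :
    ∀ s : Store, s 2 = [true] →
    (∀ k, ∀ h : k < D.length, W (true :: false :: ((D.take k).reverse ++ s 1)) = true ∧
      W (true :: true :: ((D.take k).reverse ++ s 1)) = D[k]) →
    W (true :: false :: (D.reverse ++ s 1)) = false →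
    ∃ s', Runs W (Oracle.listen r) s (13 * D.length + 8) s' ∧ s' 1 = D.reverse ++ s 1 ∧
      s' 2 = [] ∧ s' r = D.reverse ++ s r ∧ ∀ i, i ≠ 1 → i ≠ 2 → i ≠ r → s' i = s i := by
  induction D with
  | nil =>
    intro s hs _ hW
    refine ⟨Function.update s 2 [], ?_, by simp, by simp, by simp [hr2], fun i _ h _ => by simp [h]⟩
    have : Runs W (Oracle.listen r) s ((1 + 5) + 1 + 1) (Function.update s 2 []) := by
      refine Runs.loopStep (T₁ := 1 + 5) (T₂ := 1) (s₁ := Function.update s 2 []) (by simp [hs])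
        (Runs.ask (b := false) hW ?_) (Runs.loopDone (Function.update_self ..))
      have := Runs.pop (W := W) (s := s) (r := 2)
      rw [hs] at this
      simpa using this
    exact this.mono (by simp)
  | cons b D ih =>
    intro s hs hD hW
    obtain ⟨h0, h0'⟩ := hD 0 (by simp)
    simp only [List.take_zero, List.reverse_nil, List.nil_append, List.getElem_cons_zero] at h0 h0'
    let s₁ : Store := Function.update s 1 (b :: s 1)
    let s₂ : Store := Function.update s₁ r (b :: s₁ r)
    have e1 : s₂ 1 = b :: s 1 := by simp [s₂, s₁, hr1.symm]
    obtain ⟨s', hrun, h1, h2, h3, h4⟩ := ih s₂ (by simp [s₂, s₁, hr2.symm, hs])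
      (fun k hk => by
        have := hD (k + 1) (by simpa using hk)
        simpa [e1] using this)
      (by simpa [e1] using hW)
    refine ⟨s', ?_, by simp [h1, e1], h2, by simp [h3, s₂, s₁, hr1], fun i hi1 hi2 hir => by
      simp [h4 i hi1 hi2 hir, s₂, s₁, hi1, hir]⟩
    have : Runs W (Oracle.listen r) s ((((1 + 1) + 5) + 5) + (13 * D.length + 8) + 1) s' := by
      refine Runs.loopStep (s₁ := s₂) (by simp [hs]) (Runs.ask h0 ?_) hrun
      refine Runs.ask (b := b) h0' ?_
      cases b <;> exact (Runs.push _).seq (Runs.push _)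
    exact this.mono (by simp; omega)

/-- Write the bits of a list on tape `r`, one after the other. -/
def pushAll (r : ℕ) : List Bool → Prog
  | [] => .skip
  | b :: l => (Prog.push r b).seq (pushAll r l)

theorem Runs.pushAll {W : Oracle} {r : ℕ} (l : List Bool) (s : Store) :
    Runs W (Oracle.pushAll r l) s (l.length + 1) (Function.update s r (l.reverse ++ s r)) := by
  induction l generalizing s with
  | nil => exact ⟨1, by simp, by simpa [Oracle.pushAll] using Exec.skip s⟩
  | cons b l ih =>
    have := (Runs.push (W := W) (s := s) (r := r) b).seq (ih (Function.update s r (b :: s r)))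
    simpa [Oracle.pushAll, add_comm] using this

/-- The self-delimiting form of a string: every bit is preceded by `true`. -/
def pairs (x : List Bool) : List Bool := x.flatMap fun b => [true, b]

/-- Move the content of tape `0` to tape `1`, in self-delimiting form. -/
def movePairs : Prog :=
  .loop 0 ((Prog.branch 0 .skip ((Prog.push 1 true).seq (.push 1 false))
    ((Prog.push 1 true).seq (.push 1 true))).seq (.pop 0))

theorem Runs.movePairs {W : Oracle} (x : List Bool) : ∀ s : Store, s 0 = x →
    ∃ s', Runs W Oracle.movePairs s (5 * x.length + 1) s' ∧ s' 0 = [] ∧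
      s' 1 = (pairs x).reverse ++ s 1 ∧ ∀ i, i ≠ 0 → i ≠ 1 → s' i = s i := by
  induction x with
  | nil => intro s hs; exact ⟨s, Runs.loopDone hs, hs, by simp [pairs], fun _ _ _ => rfl⟩
  | cons b x ih =>
    intro s hs
    let s₁ : Store := Function.update s 1 (b :: true :: s 1)
    let s₂ : Store := Function.update s₁ 0 x
    obtain ⟨s', hrun, h0, h1, h2⟩ := ih s₂ (by simp [s₂])
    refine ⟨s', ?_, h0, by simp [h1, s₂, s₁, pairs], fun i hi hi' => by
      simp [h2 i hi hi', s₂, s₁, hi, hi']⟩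
    have e : s₂ = Function.update s₁ 0 (s₁ 0).tail := by simp [s₂, s₁, hs]
    have : Runs W Oracle.movePairs s ((((1 + 1) + 1) + 1) + (5 * x.length + 1) + 1) s' := by
      refine Runs.loopStep (s₁ := s₂) (by simp [hs]) (Runs.seq (s₁ := s₁) ?_ (e ▸ Runs.pop)) hrun
      refine Runs.branch (b := b) (by simp [hs]) ?_
      have key : ∀ b : Bool, Runs W ((Prog.push 1 true).seq (.push 1 b)) s (1 + 1)
          (Function.update s 1 (b :: true :: s 1)) := fun b => by
        simpa using (Runs.push (W := W) (s := s) (r := 1) true).seq (Runs.push (r := 1) b)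
      cases b <;> exact key _
    exact this.mono (by simp; omega)

/-- Move the content of tape `3` to tape `0`, reversing it. -/
def moveOut : Prog :=
  .loop 3 ((Prog.branch 3 .skip (.push 0 false) (.push 0 true)).seq (.pop 3))

theorem Runs.moveOut {W : Oracle} (x : List Bool) : ∀ s : Store, s 3 = x →
    ∃ s', Runs W Oracle.moveOut s (4 * x.length + 1) s' ∧ s' 0 = x.reverse ++ s 0 := by
  induction x with
  | nil => intro s hs; exact ⟨s, Runs.loopDone hs, by simp⟩
  | cons b x ih =>
    intro s hs
    let s₁ : Store := Function.update s 0 (b :: s 0)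
    let s₂ : Store := Function.update s₁ 3 x
    obtain ⟨s', hrun, h0⟩ := ih s₂ (by simp [s₂])
    refine ⟨s', ?_, by simp [h0, s₂, s₁]⟩
    have e : s₂ = Function.update s₁ 3 (s₁ 3).tail := by simp [s₂, s₁, hs]
    have : Runs W Oracle.moveOut s (((1 + 1) + 1) + (4 * x.length + 1) + 1) s' := by
      refine Runs.loopStep (s₁ := s₂) (by simp [hs]) (Runs.seq (s₁ := s₁) ?_ (e ▸ Runs.pop)) hrun
      refine Runs.branch (b := b) (by simp [hs]) ?_
      cases b <;> exact Runs.push _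
    exact this.mono (by simp; omega)

/-- The part of the content of tape `1`, read from the bottom, that precedes the transcript of the
dialogue with the oracle: the input `x` and the number of the task. -/
def header (code : ℕ) (x : List Bool) : List Bool :=
  pairs x ++ false :: (List.replicate code true ++ [false])

/-- Write the input and the number of the task on tape `1`, and carry on two dialogues with the
oracle, in which the oracle chooses the bits and decides when to stop. The bits of the first
dialogue only inform the oracle, those of the second one are the output. -/
def guided (code : ℕ) : Prog :=
  movePairs.seq ((pushAll 1 (false :: (List.replicate code true ++ [false]))).seq
    ((Prog.push 2 true).seq ((listen 4).seq
    ((Prog.push 1 false).seq ((Prog.push 2 true).seq ((listen 3).seq moveOut))))))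

/-- The lists `D` and `y` consist of the bits that the oracle chooses in the two dialogues; the bit
`false` between them allows the oracle to tell the end of the first from the start of the second. -/
theorem outputsWithin_guided {W : Oracle} {code : ℕ} {x D y : List Bool}
    (hD : ∀ k, ∀ h : k < D.length,
      W (true :: false :: ((D.take k).reverse ++ (header code x).reverse)) = true ∧
      W (true :: true :: ((D.take k).reverse ++ (header code x).reverse)) = D[k])
    (hD' : W (true :: false :: (D.reverse ++ (header code x).reverse)) = false)
    (hy : ∀ k, ∀ h : k < y.length,
      W (true :: false :: ((y.take k).reverse ++
        false :: (D.reverse ++ (header code x).reverse))) = true ∧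
      W (true :: true :: ((y.take k).reverse ++
        false :: (D.reverse ++ (header code x).reverse))) = y[k])
    (hy' : W (true :: false :: (y.reverse ++
        false :: (D.reverse ++ (header code x).reverse))) = false) :
    OutputsWithin W (guided code) [x]
      (17 * (x.length + code + D.length + y.length) + 30) y := by
  obtain ⟨s₁, r₁, a0, a1, a2⟩ := Runs.movePairs (W := W) x (initStore [x]) rfl
  have r₂ := Runs.pushAll (W := W) (r := 1) (false :: (List.replicate code true ++ [false])) s₁
  set s₂ := Function.update s₁ 1 ((false :: (List.replicate code true ++ [false])).reverse ++ s₁ 1)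
    with hs₂
  have b1 : s₂ 1 = (header code x).reverse := by
    simp [hs₂, a1, header, initStore]
  have b2 : s₂ 2 = [] := by simp [hs₂, a2, initStore]
  have b3 : s₂ 3 = [] := by simp [hs₂, a2, initStore]
  have b0 : s₂ 0 = [] := by simp [hs₂, a0]
  have r₃ := Runs.push (W := W) (s := s₂) (r := 2) true
  set s₃ := Function.update s₂ 2 (true :: s₂ 2) with hs₃
  have c1 : s₃ 1 = (header code x).reverse := by simp [hs₃, b1]
  obtain ⟨s₄, r₄, d1, d2, -, d3⟩ := Runs.listen (W := W) (r := 4) (by simp) (by simp) D s₃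
    (by simp [hs₃, b2]) (by simpa [c1] using hD) (by simpa [c1] using hD')
  have r₅ := Runs.push (W := W) (s := s₄) (r := 1) false
  set s₅ := Function.update s₄ 1 (false :: s₄ 1) with hs₅
  have r₆ := Runs.push (W := W) (s := s₅) (r := 2) true
  set s₆ := Function.update s₅ 2 (true :: s₅ 2) with hs₆
  have e1 : s₆ 1 = false :: (D.reverse ++ (header code x).reverse) := by
    simp [hs₆, hs₅, d1, c1]
  have e3 : s₆ 3 = [] := by simp [hs₆, hs₅, d3, hs₃, b3]
  have e0 : s₆ 0 = [] := by simp [hs₆, hs₅, d3, hs₃, b0]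
  obtain ⟨s₇, r₇, -, -, f3, f⟩ := Runs.listen (W := W) (r := 3) (by simp) (by simp) y s₆
    (by simp [hs₆, hs₅, d2]) (by simpa only [e1] using hy) (by simpa only [e1] using hy')
  obtain ⟨s₈, r₈, g0⟩ := Runs.moveOut (W := W) y.reverse s₇ (by simp [f3, e3])
  obtain ⟨t, ht, h⟩ := r₁.seq (r₂.seq (r₃.seq (r₄.seq (r₅.seq (r₆.seq (r₇.seq r₈))))))
  refine ⟨t, ht.trans ?_, s₈, h, ?_⟩
  · simp; omega
  · rw [g0, f 0 (by simp) (by simp) (by simp), e0]; simp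

/-! ### Unique readability of formulas -/

theorem natBits_injective : Function.Injective Nat.bits := fun m n h =>
  Nat.eq_of_testBit_eq fun i => by rw [Nat.testBit_eq_inth, Nat.testBit_eq_inth, h]

theorem encodeNat_append_inj {m n : ℕ} {l l' : List Bool}
    (h : encodeNat m ++ l = encodeNat n ++ l') : m = n ∧ l = l' := by
  have key : ∀ a b : List Bool,
      (a.flatMap fun b => [b, b]) ++ ([false, true] ++ l) =
        (b.flatMap fun b => [b, b]) ++ ([false, true] ++ l') → a = b ∧ l = l' := by
    intro a
    induction a with
    | nil =>
      intro b h
      cases b with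
      | nil => simpa using h
      | cons c b => cases c <;> simp at h
    | cons c a ih =>
      intro b h
      cases b with
      | nil => cases c <;> simp at h
      | cons d b =>
        simp only [List.flatMap_cons, List.cons_append, List.nil_append, List.cons.injEq] at h
        obtain ⟨h1, h2⟩ := ih b (by simpa using h.2.2)
        exact ⟨by rw [h.1, h1], h2⟩
  obtain ⟨h1, h2⟩ := key _ _ (by simpa [encodeNat] using h)
  exact ⟨natBits_injective h1, h2⟩

theorem Formula.encode_append_inj (φ : Formula) : ∀ (ψ : Formula) (l l' : List Bool),
    φ.encode ++ l = ψ.encode ++ l' → φ = ψ ∧ l = l' := by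
  induction φ with
  | var i =>
    intro ψ l l' h
    cases ψ <;> simp [Formula.encode] at h
    obtain ⟨rfl, rfl⟩ := encodeNat_append_inj h
    exact ⟨rfl, rfl⟩
  | verum | falsum =>
    intro ψ l l' h
    cases ψ <;> simp [Formula.encode] at h
    exact ⟨rfl, h⟩
  | neg φ ih =>
    intro ψ l l' h
    cases ψ <;> simp [Formula.encode] at h
    obtain ⟨rfl, rfl⟩ := ih _ _ _ h
    exact ⟨rfl, rfl⟩
  | and φ₁ φ₂ ih₁ ih₂ | or φ₁ φ₂ ih₁ ih₂ =>
    intro ψ l l' h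
    cases ψ <;> simp [Formula.encode] at h
    obtain ⟨rfl, h'⟩ := ih₁ _ _ _ h
    obtain ⟨rfl, rfl⟩ := ih₂ _ _ _ h'
    exact ⟨rfl, rfl⟩
  | oracle k args ih =>
    intro ψ l l' h
    cases ψ with
    | oracle k' args' =>
      simp only [Formula.encode, List.cons_append, List.nil_append, List.append_assoc,
        List.cons.injEq, true_and] at h
      obtain ⟨rfl, h⟩ := encodeNat_append_inj h
      have key : ∀ (m : ℕ) (f g : Fin m → Formula),
          (∀ j, ∀ (ψ : Formula) (l l' : List Bool),
            (f j).encode ++ l = ψ.encode ++ l' → f j = ψ ∧ l = l') →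
          (List.ofFn fun j => (f j).encode).flatten ++ l =
            (List.ofFn fun j => (g j).encode).flatten ++ l' → f = g ∧ l = l' := by
        intro m
        induction m with
        | zero => intro f g _ h; exact ⟨Subsingleton.elim _ _, by simpa using h⟩
        | succ m ihm =>
          intro f g hf h
          simp only [List.ofFn_succ, List.flatten_cons, List.append_assoc] at h
          obtain ⟨h0, h⟩ := hf 0 _ _ _ h
          obtain ⟨h1, h⟩ := ihm (fun j => f j.succ) (fun j => g j.succ) (fun j => hf j.succ) h
          refine ⟨funext fun j => ?_, h⟩
          cases j using Fin.cases with
          | zero => exact h0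
          | succ j => exact congrFun h1 j
      obtain ⟨rfl, rfl⟩ := key k args args' ih h
      exact ⟨rfl, rfl⟩
    | _ => simp [Formula.encode] at h

theorem Formula.encode_injective : Function.Injective Formula.encode := fun φ ψ h =>
  (φ.encode_append_inj ψ [] [] (by rw [h])).1

/-- The formula `¬α(⊥, p₀, …, pₙ₋₁)`. It is a tautology relative to `W` iff `W` contains no
string `false :: u` with `u` of length `n`. -/
def emptiness (n : ℕ) : Formula :=
  .neg (.oracle (n + 1) (Fin.cons .falsum fun j => .var j))

theorem emptiness_mem_TAUT {W : Oracle} {n : ℕ} :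
    (emptiness n).encode ∈ TAUT W ↔ ∀ u : List Bool, u.length = n → W (false :: u) = false := by
  have key : ∀ v : ℕ → Bool, (emptiness n).eval W v =
      !(W (false :: List.ofFn fun j : Fin n => v j)) := by
    intro v
    simp [emptiness, Formula.eval, List.ofFn_succ]
  constructor
  · rintro ⟨φ, hφ, h⟩ u rfl
    obtain rfl := Formula.encode_injective hφ
    have := h fun i => u.getD i false
    rw [key] at this
    have e : (List.ofFn fun j : Fin u.length => u.getD j false) = u := by
      apply List.ext_getElem <;> simp
    rw [e] at this
    simpa using this
  · intro h
    exact ⟨_, rfl, fun v => by rw [key, h _ (by simp)]; rfl⟩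

theorem verum_mem_TAUT {W : Oracle} : Formula.verum.encode ∈ TAUT W :=
  ⟨_, rfl, fun _ => rfl⟩

theorem encodeNat_length_le (n : ℕ) : (encodeNat n).length ≤ 2 * n + 2 := by
  have h1 : ∀ l : List Bool, (l.flatMap fun b => [b, b]).length = 2 * l.length := by
    intro l; induction l with
    | nil => rfl
    | cons b l ih => simp [ih]; omega
  have h2 : (Nat.bits n).length ≤ n := by
    rw [Nat.size_eq_bits_len, Nat.size_le]
    exact Nat.lt_two_pow_self
  simp only [encodeNat, List.length_append, h1, List.length_cons, List.length_nil]
  omega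

theorem emptiness_encode_length_le (n : ℕ) :
    (emptiness n).encode.length ≤ (n + 1) * (2 * n + 5) + (2 * n + 10) := by
  have h := encodeNat_length_le (n + 1)
  have h1 : ∀ (f : Fin (n + 1) → List Bool) (b : ℕ), (∀ j, (f j).length ≤ b) →
      (List.ofFn f).flatten.length ≤ (n + 1) * b := by
    intro f b hf
    rw [List.length_flatten, List.map_ofFn, List.sum_ofFn]
    refine (Finset.sum_le_card_nsmul _ _ b fun j _ => hf j).trans (by simp)
  have h2 := h1 (fun j => (Fin.cons (α := fun _ => Formula) .falsum (fun j : Fin n => .var j) j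
      : Formula).encode) (2 * n + 5) (fun j => by
    cases j using Fin.cases with
    | zero => simp [Formula.encode]
    | succ j =>
      have := encodeNat_length_le j
      simp only [Fin.cons_succ, Formula.encode, List.length_append, List.length_cons,
        List.length_nil]
      omega)
  simp only [emptiness, Formula.encode, List.length_append, List.length_cons, List.length_nil]
  omega

/-! ### Enumeration of programs and polynomials -/

/-- An injective numbering of programs. -/
def Prog.toNat : Prog → ℕ
  | .skip => Nat.pair 0 0
  | .push r b => Nat.pair 1 (Nat.pair r b.toNat)
  | .pop r => Nat.pair 2 r
  | .seq p q => Nat.pair 3 (Nat.pair p.toNat q.toNat)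
  | .branch r p q q' => Nat.pair 4 (Nat.pair r (Nat.pair p.toNat (Nat.pair q.toNat q'.toNat)))
  | .loop r p => Nat.pair 5 (Nat.pair r p.toNat)
  | .query r p q => Nat.pair 6 (Nat.pair r (Nat.pair p.toNat q.toNat))

theorem Prog.toNat_injective : Function.Injective Prog.toNat := by
  intro p
  induction p with
  | push r b =>
    intro q h
    cases q <;> simp [Prog.toNat, Nat.pair_eq_pair] at h
    obtain ⟨rfl, h⟩ := h
    revert h
    cases b <;> rename_i b' <;> cases b' <;> simp
  | _ =>
    intro q h
    cases q <;> simp [Prog.toNat, Nat.pair_eq_pair] at h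
    grind

instance : Countable Prog := Prog.toNat_injective.countable

instance : Inhabited Prog := ⟨.skip⟩

instance : Countable (Polynomial ℕ) := by
  rw [← Cardinal.mk_le_aleph0_iff]
  exact Polynomial.cardinalMk_le_max.trans (by simp)

/-- The tuples of a program and two polynomials. They stand for search problems (a program deciding
the relation, its running time, and the bound on solutions) and for the claims that a proof system
is optimal (a program computing it, its running time, and the polynomial of a simulation). -/
abbrev Task : Type := Prog × Polynomial ℕ × Polynomial ℕ

theorem exists_surjective_task : ∃ f : ℕ → Task, Function.Surjective f :=
  exists_surjective_nat Task

/-- An enumeration of all tasks. -/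
noncomputable def task : ℕ → Task := exists_surjective_task.choose

theorem task_surjective : Function.Surjective task := exists_surjective_task.choose_spec

theorem eval_mono (p : Polynomial ℕ) {m n : ℕ} (h : m ≤ n) : p.eval m ≤ p.eval n := by
  rw [Polynomial.eval_eq_sum_range, Polynomial.eval_eq_sum_range]
  gcongr

theorem eventually_eval_lt_two_pow (p : Polynomial ℕ) :
    ∀ᶠ n : ℕ in Filter.atTop, p.eval n < 2 ^ n := by
  have key : Filter.Tendsto (fun n : ℕ => ((p.eval n : ℕ) : ℝ) / 2 ^ n) Filter.atTop (nhds 0) := by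
    induction p using Polynomial.induction_on' with
    | add p q hp hq =>
      simpa [add_div] using hp.add hq
    | monomial k a =>
      have := (tendsto_pow_const_div_const_pow_of_one_lt k (r := (2 : ℝ)) (by norm_num)).const_mul
        (a : ℝ)
      simpa [Polynomial.eval_monomial, mul_div_assoc] using this
  filter_upwards [key.eventually (gt_mem_nhds one_pos)] with n hn
  rw [div_lt_one (by positivity)] at hn
  exact_mod_cast hn

/-! ### Worlds -/

/-- A secret `(u, r)`: a string `u`, which belongs to the oracle, and the length `r` of queries from
which on the answers of the oracle may reveal `u`. -/
abbrev Secret : Type := List Bool × ℕ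

/-- The secrets that the answer to the query `S` may depend on: those which are old, and those
which are spelled in `S`. -/
def view (A : Set Secret) (S : List Bool) : Set Secret :=
  {a ∈ A | a.2 ≤ S.length ∨ a.1 <:+: S}

theorem view_view {A : Set Secret} {S S' : List Bool} (h : S <:+: S') :
    view (view A S') S = view A S := by
  ext a
  constructor
  · exact fun ha => ⟨ha.1.1, ha.2⟩
  · exact fun ha => ⟨⟨ha.1, ha.2.imp (fun h' => h'.trans h.length_le) fun h' => h'.trans h⟩, ha.2⟩

/-- Inverse to `pairs`: the decoded string and the remaining part, without the end marker. -/
def parsePairs : List Bool → List Bool × List Bool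
  | true :: b :: l => (b :: (parsePairs l).1, (parsePairs l).2)
  | _ :: l => ([], l)
  | [] => ([], [])

/-- Read a number in unary. -/
def parseUnary : List Bool → ℕ × List Bool
  | true :: l => ((parseUnary l).1 + 1, (parseUnary l).2)
  | false :: l => (0, l)
  | [] => (0, [])

theorem parsePairs_pairs (x l : List Bool) : parsePairs (pairs x ++ false :: l) = (x, l) := by
  induction x with
  | nil => rfl
  | cons b x ih =>
    have : pairs (b :: x) ++ false :: l = true :: b :: (pairs x ++ false :: l) := by simp [pairs]
    rw [this, parsePairs, ih]

theorem parseUnary_replicate (n : ℕ) (l : List Bool) :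
    parseUnary (List.replicate n true ++ false :: l) = (n, l) := by
  induction n with
  | zero => rfl
  | succ n ih => rw [List.replicate_succ, List.cons_append, parseUnary, ih]

/-- The input, the number of the task and the transcript, read off from tape `1`. -/
def parse (S : List Bool) : List Bool × ℕ × List Bool :=
  ((parsePairs S.reverse).1, parseUnary (parsePairs S.reverse).2)

theorem parse_header (code : ℕ) (x bs : List Bool) :
    parse (bs.reverse ++ (header code x).reverse) = (x, code, bs) := by
  have : (bs.reverse ++ (header code x).reverse).reverse =
      pairs x ++ false :: (List.replicate code true ++ false :: bs) := by simp [header]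
  rw [parse, this, parsePairs_pairs, parseUnary_replicate]

/-- A bound on the length of the queries made in verifying a solution of the search problem `e` on
inputs of length `m`, increased by `c`. -/
noncomputable def queryBound (e : Task) (c m : ℕ) : ℕ :=
  c + (m + e.2.2.eval m) + e.2.1.eval (m + e.2.2.eval m)

/-- The program of `e` accepts `(x, y)`, in the running time of `e`, and `y` is short. -/
def IsSol (e : Task) (O : Oracle) (x y : List Bool) : Prop :=
  y.length ≤ e.2.2.eval x.length ∧
    OutputsWithin O e.1 [x, y] (e.2.1.eval (x.length + y.length)) [true]

theorem IsSol.exists_queries {e : Task} {O : Oracle} {x y : List Bool} (h : IsSol e O x y)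
    (c : ℕ) : ∃ Qs : List (List Bool), Qs.length ≤ queryBound e c x.length ∧
      (∀ q ∈ Qs, q.length ≤ queryBound e c x.length) ∧
      ∀ O' : Oracle, (∀ q ∈ Qs, O' q = O q) → IsSol e O' x y := by
  obtain ⟨hy, h⟩ := h
  have hM := eval_mono e.2.1 (Nat.add_le_add_left hy x.length)
  obtain ⟨Qs, h1, h2, h3⟩ := h.exists_queries (M := x.length + e.2.2.eval x.length) (by
    simp; omega)
  refine ⟨Qs, ?_, fun q hq => (h2 q hq).trans ?_, fun O' hO => ⟨hy, h3 O' hO⟩⟩ <;>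
  · unfold queryBound; omega

theorem IsSol.congr {e : Task} {O O' : Oracle} {x y : List Bool} (h : IsSol e O x y) {c : ℕ}
    (hO : ∀ q : List Bool, q.length ≤ queryBound e c x.length → O' q = O q) : IsSol e O' x y := by
  obtain ⟨Qs, -, h2, h3⟩ := h.exists_queries c
  exact h3 O' fun q hq => hO q (h2 q hq)

/-- A solution `y` of the search problem `e` on `x`, with the concatenation `t` of the queries that
are made in verifying it. -/
def IsCertificate (e : Task) (c : ℕ) (O : Oracle) (x y t : List Bool) : Prop :=
  y.length ≤ e.2.2.eval x.length ∧ t.length ≤ queryBound e c x.length * queryBound e c x.length ∧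
    ∀ O' : Oracle, (∀ q : List Bool, q.length ≤ queryBound e c x.length → q <:+: t → O' q = O q) →
      IsSol e O' x y

theorem IsSol.exists_certificate {e : Task} {O : Oracle} {x y : List Bool} (h : IsSol e O x y)
    (c : ℕ) : ∃ t, IsCertificate e c O x y t := by
  obtain ⟨Qs, h1, h2, h3⟩ := h.exists_queries c
  refine ⟨Qs.flatten, h.1, ?_, fun O' hO => h3 O' fun q hq => hO q (h2 q hq) ?_⟩
  · rw [List.length_flatten]
    refine (List.sum_le_card_nsmul _ (queryBound e c x.length) ?_).trans ?_
    · simpa using h2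
    · simpa using Nat.mul_le_mul_right _ h1
  · obtain ⟨l₁, l₂, rfl⟩ := List.append_of_mem hq
    exact ⟨l₁.flatten, l₂.flatten, by simp⟩

open Classical in
/-- What the oracle says in a dialogue on the input `x`, if the task has number `code` and `O` is
the oracle that is accessible: the output, and the text to be spelled in the first dialogue.
A number `Nat.pair g 0` asks for `emptiness |x|` if `|x|` is in the region of the proof system of
`task g`, that is, if `task (Nat.unpair |x|).1` has the same program.
A number `Nat.pair g (c + 1)` asks for a solution of the search problem `task g`. -/
noncomputable def plan (code : ℕ) (x : List Bool) (O : Oracle) : List Bool × List Bool :=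
  if (Nat.unpair code).2 = 0 then
    (if (task (Nat.unpair x.length).1).1 = (task (Nat.unpair code).1).1
      then (emptiness x.length).encode else Formula.verum.encode, [])
  else if h : ∃ c : List Bool × List Bool,
      IsCertificate (task (Nat.unpair code).1) (Nat.unpair code).2 O x c.1 c.2
    then (h.choose.1, h.choose.2.reverse) else ([], [])

/-- The length of the queries that are answered in the simulations for the task `code`. -/
noncomputable def radius (code m : ℕ) : ℕ :=
  queryBound (task (Nat.unpair code).1) (Nat.unpair code).2 m

/-- The number of bits of the first dialogue: some to make the queries longer than `radius`, the
others to spell the text. -/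
noncomputable def rounds (code m : ℕ) : ℕ := radius code m + 1 + radius code m * radius code m

/-- The answer of the oracle after `k` bits of a dialogue: if `tag` is `true`, the next bit,
otherwise, whether the current dialogue goes on. -/
noncomputable def reply (tag : Bool) (code : ℕ) (x : List Bool) (k : ℕ) (O : Oracle) : Bool :=
  if tag then
    if k < rounds code x.length then
      (plan code x O).2.getD (k - (radius code x.length + 1)) false
    else (plan code x O).1.getD (k - (rounds code x.length + 1)) false
  else
    decide (k ≠ rounds code x.length ∧
      k ≠ rounds code x.length + 1 + (plan code x O).1.length)

open Classical in
/-- The oracle given by a set of secrets. It contains `false :: u` for every secret string `u`;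
the queries starting with `true` carry on the dialogues. The simulations for the second dialogue
use the view at the end of the first one. -/
noncomputable def world (A : Set Secret) : Oracle
  | [] => false
  | false :: u => decide (∃ r, (u, r) ∈ A)
  | [true] => false
  | true :: tag :: S =>
    let code := (parse S).2.1
    let x := (parse S).1
    let k := (parse S).2.2.length
    reply tag code x k fun s =>
      if s.length ≤ min (radius code x.length) S.length then
        world (view A (S.drop (k - rounds code x.length))) s
      else false
termination_by S => S.length
decreasing_by all_goals (simp_all; try omega)

theorem world_false_cons {A : Set Secret} {u : List Bool} :
    world A (false :: u) = true ↔ ∃ r, (u, r) ∈ A := by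
  rw [world]; simp

/-- The oracle with the answers to queries longer than `B` replaced by `false`. -/
def cutoff (B : ℕ) (O : Oracle) : Oracle := fun s => if s.length ≤ B then O s else false

/-- The answer to `S` depends only on the secrets visible in `S`. -/
theorem world_view (A : Set Secret) (S : List Bool) : world (view A S) S = world A S := by
  rcases S with _ | ⟨_ | _, _ | ⟨tag, S⟩⟩
  · simp [world]
  · rw [Bool.eq_iff_iff, world_false_cons, world_false_cons]
    exact ⟨fun ⟨r, h⟩ => ⟨r, h.1⟩, fun ⟨r, h⟩ => ⟨r, h, .inr ⟨[false], [], by simp⟩⟩⟩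
  · rw [Bool.eq_iff_iff, world_false_cons, world_false_cons]
    exact ⟨fun ⟨r, h⟩ => ⟨r, h.1⟩, fun ⟨r, h⟩ => ⟨r, h, .inr ⟨[false], [], by simp⟩⟩⟩
  · simp [world]
  · rw [world, world]
    have h : ∀ n, S.drop n <:+: true :: tag :: S := fun n =>
      ((List.drop_suffix n S).trans ⟨[true, tag], rfl⟩).isInfix
    simp only [view_view (h _)]

theorem world_congr {A A' : Set Secret} {S : List Bool} (h : view A S = view A' S) :
    world A S = world A' S := by
  rw [← world_view A, h, world_view]

/-- The answers in a dialogue, once the transcript is longer than the simulated queries. -/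
theorem world_dialogue {A : Set Secret} {tag : Bool} {code : ℕ} {x bs : List Bool}
    (h : radius code x.length ≤ bs.length) :
    world A (true :: tag :: (bs.reverse ++ (header code x).reverse)) =
      reply tag code x bs.length (cutoff (radius code x.length)
        (world (view A ((bs.take (rounds code x.length)).reverse ++ (header code x).reverse)))) := by
  rw [world]
  simp only [parse_header]
  congr 1
  funext s
  have e1 : min (radius code x.length) (bs.reverse ++ (header code x).reverse).length =
      radius code x.length := by simp; omega
  have e2 : (bs.reverse ++ (header code x).reverse).drop (bs.length - rounds code x.length) =
      (bs.take (rounds code x.length)).reverse ++ (header code x).reverse := by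
    rw [List.drop_append_of_le_length (by simp), List.drop_reverse]
    congr 2
    rcases le_total bs.length (rounds code x.length) with h | h
    · rw [List.take_of_length_le h, Nat.sub_eq_zero_of_le h, List.take_of_length_le (by simp)]
    · congr 1; omega
  rw [e1, e2, cutoff]

theorem world_dialogue_of_lt {A : Set Secret} {code : ℕ} {x bs : List Bool}
    (h : bs.length < rounds code x.length) :
    world A (true :: false :: (bs.reverse ++ (header code x).reverse)) = true := by
  rw [world]
  simp only [parse_header, reply, Bool.false_eq_true, if_false, decide_eq_true_eq]
  omega

/-! ### Correctness of the dialogues -/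

theorem world_congr_of_forall {A A' : Set Secret} {s : List Bool}
    (h : ∀ a : Secret, (a.2 ≤ s.length ∨ a.1 <:+: s) → (a ∈ A ↔ a ∈ A')) :
    world A s = world A' s := by
  apply world_congr
  ext a
  exact ⟨fun ha => ⟨(h a ha.2).1 ha.1, ha.2⟩, fun ha => ⟨(h a ha.2).2 ha.1, ha.2⟩⟩

theorem cutoff_congr {B : ℕ} {O O' : Oracle} (h : ∀ s : List Bool, s.length ≤ B → O s = O' s) :
    cutoff B O = cutoff B O' := by
  funext s
  unfold cutoff
  split_ifs with hs
  exacts [h s hs, rfl]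

/-- The content of tape `1` after the bits `bs` of a dialogue. -/
def tape (code : ℕ) (x bs : List Bool) : List Bool := bs.reverse ++ (header code x).reverse

theorem length_le_tape (code : ℕ) (x bs : List Bool) : bs.length ≤ (tape code x bs).length := by
  simp [tape]

theorem tape_infix (code : ℕ) (x bs : List Bool) (k : ℕ) :
    tape code x (bs.take k) <:+: tape code x bs := by
  have : (bs.take k).reverse <:+ bs.reverse := List.reverse_suffix.2 (List.take_prefix k bs)
  obtain ⟨l, hl⟩ := this
  exact ⟨l, [], by simp [tape, ← hl]⟩

/-- `D` is the list of the answers of the oracle in the first dialogue. -/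
def IsTranscript (A : Set Secret) (code : ℕ) (x D : List Bool) : Prop :=
  D.length = rounds code x.length ∧
    ∀ k, ∀ h : k < D.length, world A (true :: true :: tape code x (D.take k)) = D[k]

theorem exists_isTranscript (A : Set Secret) (code : ℕ) (x : List Bool) :
    ∃ D, IsTranscript A code x D := by
  suffices h : ∀ n, ∃ D : List Bool, D.length = n ∧
      ∀ k, ∀ h : k < D.length, world A (true :: true :: tape code x (D.take k)) = D[k] from h _
  intro n
  induction n with
  | zero => exact ⟨[], rfl, fun k h => absurd h (by simp)⟩
  | succ n ih =>
    obtain ⟨D, rfl, hD⟩ := ih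
    refine ⟨D ++ [world A (true :: true :: tape code x D)], by simp, fun k hk => ?_⟩
    rcases Nat.lt_succ_iff_lt_or_eq.1 (by simpa using hk : k < D.length + 1) with h | rfl
    · rw [List.take_append_of_le_length h.le, List.getElem_append_left h]; exact hD k h
    · simp

/-- The oracle that is accessible in the simulations of the second dialogue. -/
noncomputable def accessible (A : Set Secret) (code : ℕ) (x D : List Bool) : Oracle :=
  cutoff (radius code x.length) (world (view A (tape code x D)))

theorem IsTranscript.outputsWithin {A : Set Secret} {code : ℕ} {x D : List Bool}
    (hD : IsTranscript A code x D) :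
    OutputsWithin (world A) (guided code) [x]
      (17 * (x.length + code + rounds code x.length +
        (plan code x (accessible A code x D)).1.length) + 30)
      (plan code x (accessible A code x D)).1 := by
  obtain ⟨hl, hD⟩ := hD
  have hr : radius code x.length ≤ rounds code x.length := by unfold rounds; omega
  set y := (plan code x (accessible A code x D)).1 with hy
  have key : ∀ (tag : Bool) (k : ℕ),
      world A (true :: tag :: ((y.take k).reverse ++
        false :: (D.reverse ++ (header code x).reverse))) =
      reply tag code x (D.length + 1 + (y.take k).length) (accessible A code x D) := by
    intro tag k
    have := world_dialogue (A := A) (tag := tag) (code := code) (x := x)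
      (bs := D ++ false :: y.take k) (by simp; omega)
    rw [List.take_append_of_le_length hl.ge, List.take_of_length_le hl.le] at this
    simpa [add_assoc, add_comm, add_left_comm, accessible, tape] using this
  have h := outputsWithin_guided (W := world A) (code := code) (x := x) (D := D) (y := y)
    (fun k hk => ⟨?_, hD k hk⟩) ?_ (fun k hk => ⟨?_, ?_⟩) ?_
  · rwa [hl] at h
  · refine world_dialogue_of_lt ?_
    simp; omega
  · rw [world_dialogue (by omega)]
    simp [reply, hl]
  · rw [key]
    simp only [reply, Bool.false_eq_true, if_false, List.length_take, ← hy, decide_eq_true_eq]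
    omega
  · rw [key, reply, if_pos rfl, if_neg (by simp; omega), ← hy, List.length_take, hl,
      min_eq_left hk.le, Nat.add_sub_cancel_left, List.getD_eq_getElem _ _ hk]
  · have := key false y.length
    rw [List.take_length] at this
    rw [this]
    simp [reply, ← hy, hl]

theorem plan_isCertificate {g c : ℕ} {x : List Bool} {O : Oracle}
    (h : ∃ y, IsSol (task g) O x y) :
    IsCertificate (task g) (c + 1) O x (plan (Nat.pair g (c + 1)) x O).1
      (plan (Nat.pair g (c + 1)) x O).2.reverse := by
  have key : ∀ code : ℕ, (Nat.unpair code).2 ≠ 0 →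
      (∃ y, IsSol (task (Nat.unpair code).1) O x y) →
      IsCertificate (task (Nat.unpair code).1) (Nat.unpair code).2 O x (plan code x O).1
        (plan code x O).2.reverse := by
    rintro code h0 ⟨y, hy⟩
    obtain ⟨t, ht⟩ := hy.exists_certificate (Nat.unpair code).2
    have h : ∃ d : List Bool × List Bool,
        IsCertificate (task (Nat.unpair code).1) (Nat.unpair code).2 O x d.1 d.2 := ⟨(y, t), ht⟩
    rw [plan, if_neg h0, dif_pos h, List.reverse_reverse]
    exact h.choose_spec
  simpa using key (Nat.pair g (c + 1)) (by simp) (by simpa using h)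

theorem radius_pair (g c m : ℕ) : radius (Nat.pair g c) m = queryBound (task g) c m := by
  simp [radius]

/-- In the first dialogue, the simulations do not know the current secret `a`, unless it has been
revealed, and all queries are spelled that are made in verifying the solution that is found in the
world without `a`. If one of them concerns `a`, then `a` is known in the second dialogue, where the
accessible oracle is the true one. Otherwise, the solution is correct in the true world, too. -/
theorem IsTranscript.isSol {A : Set Secret} {g c : ℕ} {x D : List Bool}
    (hD : IsTranscript A (Nat.pair g (c + 1)) x D)
    (hA : ∃ y, IsSol (task g) (world A) x y)
    (hA' : ∀ a ∈ A, a.1.length ≤ queryBound (task g) (c + 1) x.length →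
      queryBound (task g) (c + 1) x.length < a.2 →
      (∀ b ∈ A, b.1.length ≤ queryBound (task g) (c + 1) x.length →
        queryBound (task g) (c + 1) x.length < b.2 → b = a) ∧
      ∃ y, IsSol (task g) (world (A \ {a})) x y) :
    IsSol (task g) (world A) x
      (plan (Nat.pair g (c + 1)) x (accessible A (Nat.pair g (c + 1)) x D)).1 := by
  obtain ⟨hl, hD⟩ := hD
  rw [← radius_pair] at hA'
  set code := Nat.pair g (c + 1) with hcode
  set B := radius code x.length with hB
  have hB' : B = queryBound (task g) (c + 1) x.length := radius_pair ..
  have hlen : ∀ bs : List Bool, bs.length ≤ (tape code x bs).length := length_le_tape code x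
  have hBD : B ≤ D.length := by rw [hl, rounds]; omega
  by_cases hcase : ∀ a ∈ A, a.1.length ≤ B → B < a.2 →
      a.2 ≤ (tape code x D).length ∨ a.1 <:+: tape code x D
  · have heq : accessible A code x D = cutoff B (world A) := by
      refine cutoff_congr fun s hs => world_congr_of_forall fun a ha => ?_
      refine ⟨fun h => h.1, fun h => ⟨h, ?_⟩⟩
      rcases ha with ha | ha
      · left; have := hlen D; omega
      · rcases le_or_gt a.2 B with h' | h'
        · left; have := hlen D; omega
        · exact hcase a h (ha.length_le.trans hs) h'
    obtain ⟨y, hy⟩ := hA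
    have hcert := plan_isCertificate (c := c) (O := accessible A code x D)
      ⟨y, hy.congr (c := c + 1) fun q hq => by rw [heq, cutoff, if_pos (hB' ▸ hq)]⟩
    refine hcert.2.2 _ fun q hq _ => ?_
    rw [heq, cutoff, if_pos (hB' ▸ hq)]
  · push Not at hcase
    obtain ⟨a, ha, ha1, ha2, ha3, ha4⟩ := hcase
    obtain ⟨huniq, y, hy⟩ := hA' a ha ha1 ha2
    have heq : ∀ k, B ≤ k → k ≤ D.length →
        cutoff B (world (view A (tape code x (D.take k)))) = cutoff B (world (A \ {a})) := by
      intro k hk hk'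
      have hk2 := hlen (D.take k)
      rw [List.length_take, min_eq_left hk'] at hk2
      refine cutoff_congr fun s hs => world_congr_of_forall fun b hb => ?_
      constructor
      · rintro ⟨h, h'⟩
        refine ⟨h, ?_⟩
        rintro rfl
        rcases h' with h' | h'
        · exact absurd (h'.trans (tape_infix code x D k).length_le) (by omega)
        · exact ha4 (h'.trans (tape_infix code x D k))
      · rintro ⟨h, h'⟩
        refine ⟨h, ?_⟩
        left
        rcases hb with hb | hb
        · omega
        · rcases le_or_gt b.2 B with h'' | h''
          · omega
          · exact absurd (huniq b h (hb.length_le.trans hs) h'') h'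
    have heq' : accessible A code x D = cutoff B (world (A \ {a})) := by
      have := heq D.length hBD le_rfl
      rwa [List.take_length] at this
    have hcert := plan_isCertificate (c := c) (O := accessible A code x D)
      ⟨y, hy.congr (c := c + 1) fun q hq => by rw [heq', cutoff, if_pos (hB' ▸ hq)]⟩
    rw [← hcode] at hcert
    set P := plan code x (accessible A code x D) with hP
    have hlen2 : P.2.length ≤ B * B := by
      have := hcert.2.1
      rwa [List.length_reverse, ← hB'] at this
    have htext : P.2 <+: D.drop (B + 1) := by
      rw [List.prefix_iff_eq_take]
      apply List.ext_getElem
      · simp only [List.length_take, List.length_drop, hl, rounds, ← hB]; omega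
      · intro n h1 h2
        have hn : B + 1 + n < D.length := by rw [hl, rounds, ← hB]; omega
        rw [List.getElem_take, List.getElem_drop, ← hD _ hn, tape, world_dialogue (by simp; omega),
          List.take_take, ← hl, min_eq_right hn.le, ← tape, heq _ (by omega) hn.le, ← heq', reply,
          if_pos rfl, if_pos (by rw [List.length_take, ← hl]; omega), ← hP, List.length_take,
          min_eq_left hn.le, ← hB, Nat.add_sub_cancel_left, List.getD_eq_getElem _ _ h1]
    have htext' : P.2.reverse <:+: tape code x D := by
      obtain ⟨l, hl'⟩ := htext
      refine ⟨l.reverse, (D.take (B + 1)).reverse ++ (header code x).reverse, ?_⟩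
      conv_rhs => rw [tape, ← List.take_append_drop (B + 1) D, ← hl']
      simp
    refine hcert.2.2 _ fun q hq hq' => ?_
    rw [heq', cutoff, if_pos (hB' ▸ hq)]
    refine world_congr_of_forall fun b hb => ⟨fun h => ⟨h, ?_⟩, fun h => h.1⟩
    rintro rfl
    rcases hb with hb | hb
    · omega
    · exact ha4 (hb.trans (hq'.trans htext'))

/-! ### Construction of the secrets -/

/-- Relative to `O`, the proof system of `e` has a proof of `emptiness n` that is as short as the
polynomial of `e` demands for a proof of length `n + 1` in the simulated proof system. -/
def Proves (e : Task) (O : Oracle) (n : ℕ) : Prop :=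
  ∃ π : List Bool, π.length ≤ e.2.2.eval (n + 1) ∧
    OutputsWithin O e.1 [π] (e.2.1.eval π.length) (emptiness n).encode

/-- The running time of the proof system of `e` on the proofs considered in `Proves e O n`. -/
noncomputable def proofTime (e : Task) (n : ℕ) : ℕ := e.2.1.eval (e.2.2.eval (n + 1))

/-- A bound on the length of the queries made on the proofs considered in `Proves e O n`. -/
noncomputable def proofRadius (e : Task) (n : ℕ) : ℕ := e.2.2.eval (n + 1) + proofTime e n

theorem exists_not_infix {n b : ℕ} (Qs : List (List Bool)) (hb : ∀ q ∈ Qs, q.length ≤ b)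
    (h : Qs.length * (b + 1) < 2 ^ n) :
    ∃ z : List Bool, z.length = n ∧ ∀ q ∈ Qs, ¬ z <:+: q := by
  classical
  let C : Finset (List Bool) :=
    Qs.toFinset.biUnion fun q => (Finset.range (b + 1)).image fun a => (q.drop a).take n
  let V : Finset (List Bool) := Finset.univ.image fun v : Fin n → Bool => List.ofFn v
  have hC : C.card ≤ Qs.length * (b + 1) := by
    refine (Finset.card_biUnion_le_card_mul _ _ (b + 1) fun q _ => ?_).trans
      (Nat.mul_le_mul_right _ (List.toFinset_card_le Qs))
    exact Finset.card_image_le.trans (by simp)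
  have hV : V.card = 2 ^ n := by
    rw [Finset.card_image_of_injective _ List.ofFn_injective]; simp
  obtain ⟨z, hz, hz'⟩ := Finset.exists_mem_notMem_of_card_lt_card (hC.trans_lt (hV ▸ h))
  obtain ⟨v, -, rfl⟩ := Finset.mem_image.1 hz
  refine ⟨List.ofFn v, List.length_ofFn, fun q hq hin => hz' ?_⟩
  obtain ⟨l₁, l₂, rfl⟩ := hin
  refine Finset.mem_biUnion.2 ⟨_, List.mem_toFinset.2 hq, Finset.mem_image.2
    ⟨l₁.length, Finset.mem_range.2 ?_, by simp⟩⟩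
  have := hb _ hq
  simp at this
  omega

/-- Stage `i` of the construction: `A'` arises from `A` by adding at most one secret. Here `L` and
`L'` bound the lengths that matter before and after the stage, and `K` is so large that every
search problem of index less than `i` that has an instance without solution in the world `A` has
a small such instance. If the proof system of `task i` has a short proof of some `emptiness n`,
then a secret of length `n` makes that proof wrong. -/
def IsStage (i : ℕ) (A : Set Secret) (L : ℕ) (A' : Set Secret) (L' : ℕ) : Prop :=
  ∃ K, L ≤ K ∧ K ≤ L' ∧
    (∀ j < i, (∀ x, queryBound (task j) 0 x.length < K → ∃ y, IsSol (task j) (world A) x y) →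
      ∀ x, ∃ y, IsSol (task j) (world A) x y) ∧
    ((A' = A ∧ ∃ n, (Nat.unpair n).1 = i ∧ ¬ Proves (task i) (world A) n ∧
        proofRadius (task i) n < L') ∨
      ∃ a : Secret, A' = insert a A ∧ K ≤ a.1.length ∧ a.1.length ≤ a.2 ∧ a.2 < L' ∧
        (Nat.unpair a.1.length).1 = i ∧ Proves (task i) (world A') a.1.length ∧
        proofRadius (task i) a.1.length < L')

theorem exists_isStage (i : ℕ) (A : Set Secret) (L : ℕ) : ∃ A' L', IsStage i A L A' L' := by
  have hK : ∀ m, ∃ K, L ≤ K ∧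
      ∀ j < m, (∀ x, queryBound (task j) 0 x.length < K → ∃ y, IsSol (task j) (world A) x y) →
        ∀ x, ∃ y, IsSol (task j) (world A) x y := by
    intro m
    induction m with
    | zero => exact ⟨L, le_rfl, fun j hj => absurd hj (by simp)⟩
    | succ m ih =>
      obtain ⟨K, hLK, hK⟩ := ih
      by_cases hm : ∀ x, ∃ y, IsSol (task m) (world A) x y
      · refine ⟨K, hLK, fun j hj h => ?_⟩
        rcases Nat.lt_succ_iff_lt_or_eq.1 hj with hj | rfl
        exacts [hK j hj h, hm]
      · obtain ⟨x, hx⟩ := not_forall.1 hm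
        refine ⟨max K (queryBound (task m) 0 x.length + 1), by omega, fun j hj h => ?_⟩
        rcases Nat.lt_succ_iff_lt_or_eq.1 hj with hj | rfl
        · exact hK j hj fun x' hx' => h x' (by omega)
        · exact absurd (h x (by omega)) hx
  obtain ⟨K, hLK, hK⟩ := hK i
  -- a length `n` such that `2 ^ n` exceeds the number of strings touched by a short proof
  have hlarge := eventually_eval_lt_two_pow
    ((task i).2.1.comp ((task i).2.2.comp (Polynomial.X + 1)) *
      ((task i).2.2.comp (Polynomial.X + 1) +
        (task i).2.1.comp ((task i).2.2.comp (Polynomial.X + 1)) + 1))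
  obtain ⟨N, hN⟩ := Filter.eventually_atTop.1 hlarge
  obtain ⟨n, hn, hnK, hnN⟩ : ∃ n, (Nat.unpair n).1 = i ∧ K ≤ n ∧ N ≤ n :=
    ⟨Nat.pair i (max K N), by simp, (le_max_left K N).trans (Nat.right_le_pair _ _),
      (le_max_right K N).trans (Nat.right_le_pair _ _)⟩
  have hbig : proofTime (task i) n * (proofRadius (task i) n + 1) < 2 ^ n := by
    simpa [proofTime, proofRadius] using hN n hnN
  by_cases hP : Proves (task i) (world A) n
  · obtain ⟨π, hπ, hout⟩ := hP
    have htime : (task i).2.1.eval π.length ≤ proofTime (task i) n := eval_mono _ hπ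
    obtain ⟨Qs, h1, h2, h3⟩ := hout.exists_queries (M := π.length) (by simp)
    have h2' : ∀ q ∈ Qs, q.length ≤ proofRadius (task i) n := fun q hq =>
      (h2 q hq).trans (by unfold proofRadius; omega)
    obtain ⟨z, hz, hzQ⟩ := exists_not_infix Qs h2'
      ((Nat.mul_le_mul_right _ (h1.trans htime)).trans_lt hbig)
    subst hz
    refine ⟨insert (z, z.length + proofRadius (task i) z.length + 1) A,
      z.length + proofRadius (task i) z.length + 2, K, hLK, by omega, hK, .inr
      ⟨(z, z.length + proofRadius (task i) z.length + 1), rfl, hnK, by simp only; omega,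
        by simp only; omega, hn, ⟨π, hπ, h3 _ fun q hq => ?_⟩, by simp only; omega⟩⟩
    refine world_congr_of_forall fun a ha => ?_
    constructor
    · rintro (rfl | h)
      · have := h2' q hq
        rcases ha with ha | ha
        · simp only at ha; omega
        · exact absurd ha (hzQ q hq)
      · exact h
    · exact fun h => .inr h
  · exact ⟨A, max K (proofRadius (task i) n + 1), K, hLK, by omega, hK,
      .inl ⟨rfl, n, hn, hP, by omega⟩⟩

theorem exists_stages : ∃ (A : ℕ → Set Secret) (L : ℕ → ℕ), A 0 = ∅ ∧
    ∀ i, IsStage i (A i) (L i) (A (i + 1)) (L (i + 1)) := by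
  choose f g hfg using exists_isStage
  let s : ℕ → Set Secret × ℕ := fun n =>
    Nat.rec (∅, 0) (fun i s => (f i s.1 s.2, g i s.1 s.2)) n
  exact ⟨fun i => (s i).1, fun i => (s i).2, rfl, fun i => hfg i (s i).1 (s i).2⟩

section Stages

variable {A : ℕ → Set Secret} {L : ℕ → ℕ} (h0 : A 0 = ∅)
  (hA : ∀ i, IsStage i (A i) (L i) (A (i + 1)) (L (i + 1)))

include hA

theorem stages_bound_mono : Monotone L := monotone_nat_of_le_succ fun i => by
  obtain ⟨K, h1, h2, -⟩ := hA i
  omega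

theorem stages_mono : Monotone A := monotone_nat_of_le_succ fun i => by
  obtain ⟨K, -, -, -, ⟨h, -⟩ | ⟨a, h, -⟩⟩ := hA i
  · exact h.ge
  · rw [h]; exact Set.subset_insert _ _

theorem stages_new {a : Secret} (ha : a ∈ ⋃ i, A i) (i : ℕ) :
    a ∈ A i ∨ L i ≤ a.1.length ∧ L i ≤ a.2 := by
  obtain ⟨m, hm⟩ := Set.mem_iUnion.1 ha
  clear ha
  induction m with
  | zero => exact .inl (stages_mono hA (Nat.zero_le i) hm)
  | succ m ih =>
    rcases le_or_gt (m + 1) i with hi | hi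
    · exact .inl (stages_mono hA hi hm)
    · have hL := stages_bound_mono hA (show i ≤ m by omega)
      obtain ⟨K, h1, -, -, ⟨h, -⟩ | ⟨b, h, h2, h3, -⟩⟩ := hA m
      · exact ih (h ▸ hm)
      · rw [h] at hm
        rcases hm with rfl | hm
        · right; constructor <;> omega
        · exact ih hm

theorem world_stages (i : ℕ) {s : List Bool} (hs : s.length < L i) :
    world (⋃ i, A i) s = world (A i) s := by
  refine world_congr_of_forall fun a ha => ⟨fun h => ?_, fun h => Set.mem_iUnion.2 ⟨i, h⟩⟩
  rcases stages_new hA h i with h' | ⟨h1, h2⟩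
  · exact h'
  · rcases ha with ha | ha
    · omega
    · have := ha.length_le; omega

include h0

/-- Every secret is added at some stage. -/
theorem stages_birth {a : Secret} (ha : a ∈ ⋃ i, A i) : ∃ i, a ∉ A i ∧ A (i + 1) = insert a (A i) ∧
    ∃ K, L i ≤ K ∧ K ≤ a.1.length ∧ a.1.length ≤ a.2 ∧ a.2 < L (i + 1) ∧
    (∀ j < i, (∀ x, queryBound (task j) 0 x.length < K → ∃ y, IsSol (task j) (world (A i)) x y) →
      ∀ x, ∃ y, IsSol (task j) (world (A i)) x y) ∧
    (Nat.unpair a.1.length).1 = i ∧ Proves (task i) (world (A (i + 1))) a.1.length ∧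
    proofRadius (task i) a.1.length < L (i + 1) := by
  classical
  have ha' := Set.mem_iUnion.1 ha
  obtain ⟨i, hi⟩ : ∃ i, Nat.find ha' = i + 1 := Nat.exists_eq_succ_of_ne_zero fun h => by
    have := Nat.find_spec ha'
    rw [h, h0] at this
    exact this
  have hmem : a ∈ A (i + 1) := hi ▸ Nat.find_spec ha'
  have hnot : a ∉ A i := Nat.find_min ha' (by omega)
  obtain ⟨K, h1, -, h2, ⟨h, -⟩ | ⟨b, h, h3, h4, h5, h6, h7⟩⟩ := hA i
  · exact absurd (h ▸ hmem) hnot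
  · obtain rfl : a = b := by
      rw [h] at hmem
      exact hmem.resolve_right hnot
    exact ⟨i, hnot, h, K, h1, h3, h4, h5, h2, h6, h7⟩

theorem stages_old {a : Secret} {i : ℕ} (ha : a ∈ A i) : a.2 < L i := by
  obtain ⟨m, hm, -, K, -, -, -, h, -⟩ := stages_birth h0 hA (Set.mem_iUnion.2 ⟨i, ha⟩)
  refine h.trans_le (stages_bound_mono hA ?_)
  by_contra hlt
  exact hm (stages_mono hA (by omega) ha)

/-- The set of all secrets satisfies the hypothesis of `IsTranscript.isSol`: at most one secret is
neither old nor too long to matter, and a search problem that is total in the final world stays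
total without it, since otherwise a small instance without solution would have been preserved. -/
theorem stages_search {j c : ℕ} (hc : L (j + 1) ≤ c)
    (htot : ∀ x, ∃ y, IsSol (task j) (world (⋃ i, A i)) x y) (x : List Bool) {a : Secret}
    (ha : a ∈ ⋃ i, A i) (ha1 : a.1.length ≤ queryBound (task j) c x.length)
    (ha2 : queryBound (task j) c x.length < a.2) :
    (∀ b ∈ ⋃ i, A i, b.1.length ≤ queryBound (task j) c x.length →
      queryBound (task j) c x.length < b.2 → b = a) ∧
    ∃ y, IsSol (task j) (world ((⋃ i, A i) \ {a})) x y := by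
  have hcB : c ≤ queryBound (task j) c x.length := by unfold queryBound; omega
  obtain ⟨i, hai, hins, K, hLK, hK, har, hL, hsearch, -⟩ := stages_birth h0 hA ha
  have hji : j < i := by
    by_contra hij
    have : a ∈ A (j + 1) := stages_mono hA (show i + 1 ≤ j + 1 by omega) (hins ▸ .inl rfl)
    have := stages_old h0 hA this
    omega
  have hnew : ∀ b ∈ ⋃ i, A i, b ∈ A i ∨ b = a ∨ L (i + 1) ≤ b.1.length ∧ L (i + 1) ≤ b.2 := by
    intro b hb
    rcases stages_new hA hb (i + 1) with h | h
    · rw [hins] at h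
      rcases h with h | h
      exacts [.inr (.inl h), .inl h]
    · exact .inr (.inr h)
  constructor
  · intro b hb hb1 hb2
    rcases hnew b hb with h | h | h
    · have := stages_old h0 hA h; omega
    · exact h
    · omega
  · have htot' := hsearch j hji (fun x' hx' => by
      obtain ⟨y, hy⟩ := htot x'
      refine ⟨y, hy.congr (c := 0) fun q hq => world_congr_of_forall fun b hb => ?_⟩
      refine ⟨fun h => Set.mem_iUnion.2 ⟨i, h⟩, fun h => ?_⟩
      have hlong : ¬ (K ≤ b.1.length ∧ K ≤ b.2) := by
        rintro ⟨h1, h2⟩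
        rcases hb with hb | hb
        · omega
        · have := hb.length_le; omega
      rcases hnew b h with h | rfl | h
      · exact h
      · exact absurd ⟨hK, hK.trans har⟩ hlong
      · exact absurd ⟨by omega, by omega⟩ hlong)
    obtain ⟨y, hy⟩ := htot' x
    refine ⟨y, hy.congr (c := c) fun q hq => world_congr_of_forall fun b hb => ?_⟩
    refine ⟨fun h => ?_, fun h => ⟨Set.mem_iUnion.2 ⟨i, h⟩, fun e => hai (e ▸ h)⟩⟩
    rcases hnew b h.1 with h' | h' | ⟨h1, h2⟩
    · exact h'
    · exact absurd h' h.2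
    · rcases hb with hb | hb
      · omega
      · have := hb.length_le; omega

/-- A secret whose length belongs to the region of a proof system refutes that proof system. -/
theorem stages_refute {P : List Bool → List Bool} {p : Prog} {q : Polynomial ℕ}
    (hP : ∀ x : List Bool, OutputsWithin (world (⋃ i, A i)) p [x] (q.eval x.length) (P x))
    (hrange : Set.range P ⊆ TAUT (world (⋃ i, A i))) {a : Secret} (ha : a ∈ ⋃ i, A i)
    (hp : (task (Nat.unpair a.1.length).1).1 = p) : False := by
  obtain ⟨i, -, -, K, -, -, -, -, -, rfl, ⟨π, hπ, hout⟩, hL⟩ := stages_birth h0 hA ha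
  have htime := eval_mono (task (Nat.unpair a.1.length).1).2.1 hπ
  have hout' := hout.congr (W' := world (⋃ i, A i)) (M := π.length) (by simp) fun s hs =>
    world_stages hA _ (lt_of_le_of_lt (hs.trans (by unfold proofRadius proofTime; omega)) hL)
  rw [hp] at hout'
  have heq := hout'.unique (hP π)
  have := emptiness_mem_TAUT.1 (heq ▸ hrange ⟨π, rfl⟩) a.1 rfl
  rw [world_false_cons.2 ⟨a.2, ha⟩] at this
  exact absurd this (by simp)

end Stages

/-! ### The two properties of the final world -/

theorem exists_rounds_polynomial (code : ℕ) :
    ∃ R : Polynomial ℕ, ∀ m, rounds code m = R.eval m := by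
  have h : ∃ R : Polynomial ℕ, ∀ m, radius code m = R.eval m := by
    refine ⟨Polynomial.C (Nat.unpair code).2 +
      (Polynomial.X + (task (Nat.unpair code).1).2.2) + (task (Nat.unpair code).1).2.1.comp
        (Polynomial.X + (task (Nat.unpair code).1).2.2), fun m => ?_⟩
    simp [radius, queryBound]
  obtain ⟨R, hR⟩ := h
  exact ⟨R + 1 + R * R, fun m => by simp [rounds, hR]⟩

theorem exists_guided_polynomial (code : ℕ) (p : Polynomial ℕ) :
    ∃ T : Polynomial ℕ, ∀ (A : Set Secret) (x D : List Bool), IsTranscript A code x D →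
      (plan code x (accessible A code x D)).1.length ≤ p.eval x.length →
      OutputsWithin (world A) (guided code) [x] (T.eval x.length)
        (plan code x (accessible A code x D)).1 := by
  obtain ⟨R, hR⟩ := exists_rounds_polynomial code
  refine ⟨Polynomial.C 17 * (Polynomial.X + Polynomial.C code + R + p) + Polynomial.C 30,
    fun A x D hD hle => hD.outputsWithin.mono ?_⟩
  simp only [Polynomial.eval_add, Polynomial.eval_mul, Polynomial.eval_C, Polynomial.eval_X, hR]
  omega

theorem rel_iff_outputsWithin {W : Oracle} {R : List Bool → List Bool → Prop}
    {p : Prog} {q : Polynomial ℕ} (h : ∀ x y : List Bool, ∃ out : List Bool,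
      OutputsWithin W p [x, y] (q.eval (x.length + y.length)) out ∧ (out = [true] ↔ R x y))
    (x y : List Bool) :
    R x y ↔ OutputsWithin W p [x, y] (q.eval (x.length + y.length)) [true] := by
  obtain ⟨out, hout, hR⟩ := h x y
  rw [← hR]
  exact ⟨fun e => e ▸ hout, fun h' => hout.unique h'⟩

/-- If the first bit of the input is `true`, delete it and run the dialogue program, otherwise run
`p` on the rest. -/
def combine (p : Prog) (code : ℕ) : Prog :=
  .branch 0 p ((Prog.pop 0).seq p) ((Prog.pop 0).seq (guided code))

theorem OutputsWithin.combine_nil {W : Oracle} {p : Prog} {code T : ℕ} {y : List Bool}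
    (h : OutputsWithin W p [[]] T y) : OutputsWithin W (combine p code) [[]] (T + 2) y := by
  obtain ⟨t, ht, s, hs, rfl⟩ := h
  exact ⟨t + 1, by omega, s, .branchNil rfl hs, rfl⟩

theorem OutputsWithin.combine_cons {W : Oracle} {p : Prog} {code T : ℕ} {b : Bool}
    {x y : List Bool} (h : OutputsWithin W (if b then guided code else p) [x] T y) :
    OutputsWithin W (combine p code) [b :: x] (T + 2) y := by
  obtain ⟨t, ht, s, hs, rfl⟩ := h
  have e : Function.update (initStore [b :: x]) 0 (initStore [b :: x] 0).tail = initStore [x] := by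
    funext r
    rcases r with _ | r
    · rfl
    · rw [Function.update_of_ne (by simp)]; simp [initStore]
  have hpop : Exec W (.pop 0) (initStore [b :: x]) 1 (initStore [x]) := e ▸ Exec.pop 0 _
  cases b
  · exact ⟨1 + t + 1, by omega, s, .branchFalse rfl (hpop.seq hs), rfl⟩
  · exact ⟨1 + t + 1, by omega, s, .branchTrue rfl (hpop.seq hs), rfl⟩

section Stages

variable {A : ℕ → Set Secret} {L : ℕ → ℕ} (h0 : A 0 = ∅)
  (hA : ∀ i, IsStage i (A i) (L i) (A (i + 1)) (L (i + 1)))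

include h0 hA

/-- The solutions are computed by the dialogue program. The component `L (j + 1) + 1` of the number of
the task makes `radius` so large that the secrets of the stages up to `j`, to which `stages_search`
does not apply, are old in all queries that matter. -/
theorem TFNP_subset_FP : TFNP (world (⋃ i, A i)) ⊆ FP (world (⋃ i, A i)) := by
  rintro ⟨p, R⟩ ⟨hR, htot⟩
  refine ⟨hR, ?_⟩
  obtain ⟨pr, q, hq⟩ := hR
  obtain ⟨j, hj⟩ := task_surjective (pr, q, p)
  have hsol : ∀ x y, SearchProblem.IsSolution (p, R) x y ↔
      IsSol (task j) (world (⋃ i, A i)) x y := by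
    intro x y
    rw [hj]
    exact and_congr_right fun _ => rel_iff_outputsWithin hq x y
  simp only [hsol] at htot ⊢
  obtain ⟨T, hT⟩ := exists_guided_polynomial (Nat.pair j (L (j + 1) + 1)) p
  have key : ∀ x, ∃ y, OutputsWithin (world (⋃ i, A i)) (guided (Nat.pair j (L (j + 1) + 1))) [x]
      (T.eval x.length) y ∧ IsSol (task j) (world (⋃ i, A i)) x y := by
    intro x
    obtain ⟨D, hD⟩ := exists_isTranscript (⋃ i, A i) (Nat.pair j (L (j + 1) + 1)) x
    have h := hD.isSol (htot x) fun a ha ha1 ha2 =>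
      stages_search h0 hA (Nat.le_succ _) htot x ha ha1 ha2
    refine ⟨_, hT _ x D hD ?_, h⟩
    have := h.1
    rwa [hj] at this
  choose f hf using key
  exact ⟨f, ⟨_, T, fun x => (hf x).1⟩, fun x => (hf x).2⟩

/-- The proof system that extends `P` by trivial proofs of `emptiness n`, for all `n` in the region
of `P`, is not simulated by `P`. -/
theorem no_isNonuniformPOptimal (P : List Bool → List Bool) :
    ¬ IsNonuniformPOptimal (world (⋃ i, A i)) (TAUT (world (⋃ i, A i))) P := by
  classical
  rintro ⟨⟨⟨p, q, hP⟩, hrange⟩, hopt⟩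
  obtain ⟨g, hg⟩ := task_surjective (p, q, 0)
  have htaut : ∀ n, (task (Nat.unpair n).1).1 = p →
      (emptiness n).encode ∈ TAUT (world (⋃ i, A i)) := by
    intro n hn
    refine emptiness_mem_TAUT.2 fun u hu => ?_
    rw [Bool.eq_false_iff]
    intro h
    obtain ⟨r, hr⟩ := world_false_cons.1 h
    exact stages_refute h0 hA hP hrange.le hr (by rw [hu]; exact hn)
  -- the output of `guided (Nat.pair g 0)` on inputs of length `n`
  let F : ℕ → List Bool := fun n =>
    if (task (Nat.unpair n).1).1 = p then (emptiness n).encode else Formula.verum.encode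
  have hF : ∀ n, F n ∈ TAUT (world (⋃ i, A i)) := by
    intro n
    by_cases h : (task (Nat.unpair n).1).1 = p
    · simp only [F, if_pos h]; exact htaut n h
    · simp only [F, if_neg h]; exact verum_mem_TAUT
  have hplan : ∀ x O, (plan (Nat.pair g 0) x O).1 = F x.length := by
    intro x O
    simp [plan, F, hg]
  have hFlen : ∀ n, (F n).length ≤ (n + 1) * (2 * n + 5) + (2 * n + 10) := by
    intro n
    simp only [F]
    split_ifs
    · exact emptiness_encode_length_le n
    · simp only [Formula.encode, List.length_cons, List.length_nil]; omega
  obtain ⟨T, hT⟩ := exists_guided_polynomial (Nat.pair g 0)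
    ((Polynomial.X + 1) * (2 * Polynomial.X + 5) + (2 * Polynomial.X + 10))
  have hguided : ∀ x : List Bool, OutputsWithin (world (⋃ i, A i)) (guided (Nat.pair g 0)) [x]
      (T.eval x.length) (F x.length) := by
    intro x
    obtain ⟨D, hD⟩ := exists_isTranscript (⋃ i, A i) (Nat.pair g 0) x
    have h := hT _ x D hD
    rw [hplan] at h
    exact h (by simpa using hFlen x.length)
  let Q : List Bool → List Bool
    | [] => P []
    | b :: x => if b then F x.length else P x
  have hQ : IsProofSystem (world (⋃ i, A i)) (TAUT (world (⋃ i, A i))) Q := by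
    refine ⟨⟨combine p (Nat.pair g 0), q + T + 2, ?_⟩, ?_⟩
    · rintro (_ | ⟨b, x⟩)
      · exact (hP []).combine_nil.mono (by simp)
      · have hq := eval_mono q (Nat.le_add_right x.length 1)
        have hT := eval_mono T (Nat.le_add_right x.length 1)
        cases b
        · exact (OutputsWithin.combine_cons (b := false) (hP x)).mono (by simp; omega)
        · exact (OutputsWithin.combine_cons (b := true) (hguided x)).mono (by simp; omega)
    · ext y
      constructor
      · rintro ⟨_ | ⟨_ | _, x⟩, rfl⟩
        exacts [hrange.le ⟨[], rfl⟩, hrange.le ⟨x, rfl⟩, hF _]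
      · intro hy
        obtain ⟨x, rfl⟩ := hrange.ge hy
        exact ⟨false :: x, rfl⟩
  obtain ⟨h, hsim⟩ := hopt Q hQ
  obtain ⟨i, hi⟩ := task_surjective (p, q, h)
  obtain ⟨K, -, hK, -, ⟨heq, n, hn, hnot, hL⟩ | ⟨a, heq, -, -, -, ha, -⟩⟩ := hA i
  · have hreg : (task (Nat.unpair n).1).1 = p := by rw [hn, hi]
    obtain ⟨π, hπ, hout⟩ := hsim (true :: List.replicate n true) _ (htaut n hreg)
      (by simp [Q, F, hreg])
    have hπ' : π.length ≤ (task i).2.2.eval (n + 1) := by simpa [hi] using hπ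
    refine hnot ⟨π, hπ', ?_⟩
    have htime := eval_mono (task i).2.1 hπ'
    have hrun := hP π
    rw [hout] at hrun
    rw [← heq]
    have hrun' : OutputsWithin (world (⋃ i, A i)) (task i).1 [π] ((task i).2.1.eval π.length)
        (emptiness n).encode := by rw [hi]; exact hrun
    exact hrun'.congr (M := π.length) (by simp) fun s hs => (world_stages hA _
      (lt_of_le_of_lt (hs.trans (by unfold proofRadius proofTime; omega)) hL)).symm
  · have hmem : a ∈ A (i + 1) := heq ▸ Set.mem_insert _ _
    exact stages_refute h0 hA hP hrange.le (Set.mem_iUnion.2 ⟨i + 1, hmem⟩) (by rw [ha, hi])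

end Stages

end Oracle

theorem theorem5p2 :
    ∃ W : Oracle,
      (¬ ∃ P : List Bool → List Bool, Oracle.IsNonuniformPOptimal W (Oracle.TAUT W) P) ∧
      Oracle.TFNP W = Oracle.FP W := by
  obtain ⟨A, L, h0, hA⟩ := Oracle.exists_stages
  refine ⟨Oracle.world (⋃ i, A i), fun ⟨P, hP⟩ => Oracle.no_isNonuniformPOptimal h0 hA P hP, ?_⟩
  refine (Oracle.TFNP_subset_FP h0 hA).antisymm ?_
  rintro S ⟨hR, f, -, hf⟩
  exact ⟨hR, fun x => ⟨f x, hf x⟩⟩
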